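/- For a real number $\alpha>0$ let $\mathrm{PS}(\alpha)=\{\lfloor n^\alpha\rfloor : n=1,2,3,\dots\}$, where $\lfloor x\rfloor$ and $\{x\}$ denote the integer and the fractional part of a real number $x$. For positive integers $a,b,c$, say that the equation $ax+by=cz$ is solvable in $\mathrm{PS}(\alpha)$ if there are infinitely many triples $(x,y,z)\in\mathrm{PS}(\alpha)^3$ whose entries $x,y,z$ are pairwise distinct and which satisfy $ax+by=cz$. Let $a,b,c$ be positive integers. For all real numbers $2<s<t$, the set of all $\alpha\in[s,t]$ for which $ax+by=cz$ is solvable in $\mathrm{PS}(\alpha)$ has positive Hausdorff dimension; explicitly, $$\dim_{\mathrm H}\bigl(\{\alpha\in[s,t] : ax+by=cz \text{ is solvable in } \mathrm{PS}(\alpha)\}\bigr)\ \ge\ \begin{cases}\displaystyle\Bigl(s+\frac{s^3}{(2+\{s\}-2^{1-\lfloor s\rfloor})(2-\{s\})}\Bigr)^{-1} & \text{if } a=b=c,\\[10pt] \displaystyle 2\Bigl(s+\frac{s^3}{(2+\{s\}-2^{1-\lfloor s\rfloor})(2-\{s\})}\Bigr)^{-1} & \text{otherwise.}\end{cases}$$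 -/

import Mathlib

/-- The set `PS(α) = {⌊n ^ α⌋ : n = 1, 2, 3, …}` of terms of the Piatetski-Shapiro sequence with
exponent `α`. (All the numbers `n ^ α` are positive, so `⌊·⌋₊` is the ordinary integer part.) -/
def piatetskiShapiro (α : ℝ) : Set ℕ :=
  {m | ∃ n : ℕ, 0 < n ∧ m = ⌊(n : ℝ) ^ α⌋₊}

/-- The equation `a x + b y = c z` is solvable in `P`: there are infinitely many triples
`(x, y, z) ∈ P ^ 3` with pairwise distinct entries `x, y, z` that satisfy it. -/
def IsSolvableIn (a b c : ℕ) (P : Set ℕ) : Prop :=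
  {p : ℕ × ℕ × ℕ | p.1 ∈ P ∧ p.2.1 ∈ P ∧ p.2.2 ∈ P ∧
    p.1 ≠ p.2.1 ∧ p.1 ≠ p.2.2 ∧ p.2.1 ≠ p.2.2 ∧
    a * p.1 + b * p.2.1 = c * p.2.2}.Infinite

/-- The number `(s + s³ / ((2 + {s} - 2 ^ (1 - ⌊s⌋)) (2 - {s})))⁻¹`. -/
noncomputable def dimBound (s : ℝ) : ℝ :=
  (s + s ^ 3 / ((2 + Int.fract s - (2 : ℝ) ^ (1 - ⌊s⌋)) * (2 - Int.fract s)))⁻¹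

/-!
If `y ^ α = (c - a p ^ (-α)) / b`, then `a q ^ α + b (p y q) ^ α = c (p q) ^ α`. Fix a large integer
`p`. The function `y = y(α)` (`curve`) is bi-Lipschitz near a suitable exponent close to `s`, so the
exponents `α₀` with `y(α₀) = m / q` are evenly spaced with gaps of order `1 / q`. For each of them
the integers `k q`, `k p m`, `k p q` satisfy the equation in `α₀`-th powers, for every `k`. If
`(k q) ^ α₀ / c` and `(k p m) ^ α₀ / c` are slightly larger than integers, the equation passes to the
integer parts, and it persists for all `α` in an interval `[α₀, α₀ + δ]`, where `δ` may be any power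
of `k q` with exponent less than `-α₀` (`Icc_subset_solvableAbove`). If some `k ≤ q ^ η` always
works, with `η > 0` arbitrary, then the exponents lying in such intervals for infinitely many `q`
form a set of dimension at least `d` for each `d < 1 / s` (`le_dimH_of_lattice_points`, a Cantor construction along
a sparse sequence of denominators), and `2 * dimBound s < 1 / s`.

A multiplier `k` is found without exponential sums (`exists_rpow_inArc`). With `q = K ^ g` and `k`
of size `K`, the differences of order `R + 1` of `k ↦ (k q) ^ α₀` are small for
`R = ⌊α₀ (g + 1)⌋`, but they are large compared with `1 / K`. Hence the `R`-th differences drift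
slowly around the circle and reach any prescribed arc. Prescribing a very short arc close to `0`
makes the differences of order `R - 1` drift slowly in turn, and so on down to the sequence itself
(`exists_box_of_iterate_fwdDiff`). Two sequences are handled together by letting one of them drift
much faster than the other (`exists_stay_in_box`); for the top differences the ratio of the speeds
is about `(p y) ^ α₀`, which is large because `p` is.
-/

open Set Filter Topology

/-! ### Cantor sets of mixed radix type -/

/-- The left endpoint of the `k`-th interval in the branch encoded by `x ∈ [0, 1)`. The tree of
intervals starts from `u₀`; a level-`k` interval with left endpoint `u` has `M k` children, with left
endpoints `p k u i` for `i < M k`. The branch follows the digits of `x` in the mixed radix system with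
radices `M 0, M 1, …`. -/
noncomputable def branchPoint (u₀ : ℝ) (M : ℕ → ℕ) (p : ℕ → ℝ → ℕ → ℝ) (x : ℝ) : ℕ → ℝ
  | 0 => u₀
  | k + 1 => p k (branchPoint u₀ M p x k)
      (⌊x * ∏ i ∈ Finset.range (k + 1), (M i : ℝ)⌋₊ -
        M k * ⌊x * ∏ i ∈ Finset.range k, (M i : ℝ)⌋₊)

theorem floor_mul_natCast {y : ℝ} (hy : 0 ≤ y) {m : ℕ} (hm : 0 < m) :
    m * ⌊y⌋₊ ≤ ⌊y * m⌋₊ ∧ ⌊y * m⌋₊ < m * ⌊y⌋₊ + m := by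
  have hm' : (0 : ℝ) < m := by exact_mod_cast hm
  constructor
  · refine Nat.le_floor ?_
    push_cast
    rw [mul_comm]
    exact mul_le_mul_of_nonneg_right (Nat.floor_le hy) hm'.le
  · rw [Nat.floor_lt (by positivity)]
    push_cast
    nlinarith [Nat.lt_floor_add_one y]

section Branch

variable {u₀ v₀ : ℝ} {δ : ℕ → ℝ} {M : ℕ → ℕ} {p : ℕ → ℝ → ℕ → ℝ}

theorem branchPoint_mem (hM : ∀ k, 2 ≤ M k) (h0 : u₀ + δ 0 ≤ v₀)
    (hp : ∀ k u, u₀ ≤ u → u + δ k ≤ v₀ → ∀ i < M k, u ≤ p k u i ∧ p k u i + δ (k + 1) ≤ u + δ k)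
    {x : ℝ} (hx : 0 ≤ x) (k : ℕ) :
    u₀ ≤ branchPoint u₀ M p x k ∧ branchPoint u₀ M p x k + δ k ≤ v₀ ∧
      branchPoint u₀ M p x k ≤ branchPoint u₀ M p x (k + 1) ∧
      branchPoint u₀ M p x (k + 1) + δ (k + 1) ≤ branchPoint u₀ M p x k + δ k := by
  have hdig : ∀ k, ⌊x * ∏ i ∈ Finset.range (k + 1), (M i : ℝ)⌋₊ -
        M k * ⌊x * ∏ i ∈ Finset.range k, (M i : ℝ)⌋₊ < M k := by
    intro k
    have := floor_mul_natCast (y := x * ∏ i ∈ Finset.range k, (M i : ℝ)) (by positivity)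
      (m := M k) (by have := hM k; omega)
    rw [mul_assoc, ← Finset.prod_range_succ] at this
    omega
  suffices h : u₀ ≤ branchPoint u₀ M p x k ∧ branchPoint u₀ M p x k + δ k ≤ v₀ by
    exact ⟨h.1, h.2, hp k _ h.1 h.2 _ (hdig k)⟩
  induction k with
  | zero => exact ⟨le_rfl, h0⟩
  | succ k ih =>
    have := hp k _ ih.1 ih.2 _ (hdig k)
    exact ⟨ih.1.trans this.1, this.2.trans ih.2⟩

theorem branchPoint_congr {x y : ℝ} {k : ℕ}
    (h : ∀ j ≤ k, ⌊x * ∏ i ∈ Finset.range j, (M i : ℝ)⌋₊ = ⌊y * ∏ i ∈ Finset.range j, (M i : ℝ)⌋₊) :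
    branchPoint u₀ M p x k = branchPoint u₀ M p y k := by
  induction k with
  | zero => rfl
  | succ k ih =>
    rw [branchPoint, branchPoint, ih fun j hj => h j (by omega), h k (by omega), h (k + 1) le_rfl]

end Branch

/-- A lower bound for the dimension of a Cantor type set: the map from the
Cantor set to `[0, 1)` that reads off the mixed radix expansion encoding a branch is onto
and Hölder continuous of exponent `d`. -/
theorem le_dimH_of_branching {E : ℕ → Set ℝ} {u₀ v₀ d C : ℝ} (huv : u₀ < v₀) (hd : 0 < d)
    (hd1 : d < 1) (hC : 0 < C)
    (H : ∀ δ : ℝ, 0 < δ → δ ≤ v₀ - u₀ → ∀ N : ℕ, ∃ δ' : ℝ, ∃ M : ℕ, ∃ e : ℝ,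
      0 < δ' ∧ δ' ≤ v₀ - u₀ ∧ 2 ≤ M ∧ 0 < e ∧ δ' ^ (-d) ≤ M ∧ δ ≤ C * (M * e) ∧
      ∀ u, u₀ ≤ u → u + δ ≤ v₀ → ∃ p : ℕ → ℝ,
        (∀ i < M, u ≤ p i ∧ p i + δ' ≤ u + δ ∧ Icc (p i) (p i + δ') ⊆ E N) ∧
        ∀ i j, i < j → j < M → ((j : ℝ) - i) * e ≤ p j - p i - δ') :
    ENNReal.ofReal d ≤ dimH (Icc u₀ v₀ ∩ ⋂ N, E N) := by
  choose! nδ nM ne hδ' hδ'le hM2 he hMd hMe nP using H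
  choose! P hP hPsep using nP
  let δ : ℕ → ℝ := fun k => Nat.rec (v₀ - u₀) (fun k x => nδ x k) k
  have hδ0 : δ 0 = v₀ - u₀ := rfl
  have hδs : ∀ k, δ (k + 1) = nδ (δ k) k := fun k => rfl
  have hδ : ∀ k, 0 < δ k ∧ δ k ≤ v₀ - u₀ := by
    intro k
    induction k with
    | zero => exact ⟨by rw [hδ0]; linarith, le_rfl⟩
    | succ k ih => rw [hδs]; exact ⟨hδ' _ ih.1 ih.2 k, hδ'le _ ih.1 ih.2 k⟩
  let M : ℕ → ℕ := fun k => nM (δ k) k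
  let e : ℕ → ℝ := fun k => ne (δ k) k
  let p : ℕ → ℝ → ℕ → ℝ := fun k => P (δ k) k
  have hM : ∀ k, 2 ≤ M k := fun k => hM2 _ (hδ k).1 (hδ k).2 k
  have he : ∀ k, 0 < e k := fun k => he _ (hδ k).1 (hδ k).2 k
  have hMd : ∀ k, δ (k + 1) ^ (-d) ≤ M k := fun k => hMd _ (hδ k).1 (hδ k).2 k
  have hMe : ∀ k, δ k ≤ C * (M k * e k) := fun k => hMe _ (hδ k).1 (hδ k).2 k
  have hP : ∀ k u, u₀ ≤ u → u + δ k ≤ v₀ → ∀ i < M k, u ≤ p k u i ∧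
      p k u i + δ (k + 1) ≤ u + δ k ∧ Icc (p k u i) (p k u i + δ (k + 1)) ⊆ E k :=
    fun k u => hP _ (hδ k).1 (hδ k).2 k u
  have hsep : ∀ k u, u₀ ≤ u → u + δ k ≤ v₀ → ∀ i j, i < j → j < M k →
      ((j : ℝ) - i) * e k ≤ p k u j - p k u i - δ (k + 1) :=
    fun k u => hPsep _ (hδ k).1 (hδ k).2 k u
  have h0 : u₀ + δ 0 ≤ v₀ := by rw [hδ0]; linarith
  set b := branchPoint u₀ M p with hb
  have hmem : ∀ x, 0 ≤ x → ∀ k, u₀ ≤ b x k ∧ b x k + δ k ≤ v₀ ∧ b x k ≤ b x (k + 1) ∧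
      b x (k + 1) + δ (k + 1) ≤ b x k + δ k := fun x hx k =>
    branchPoint_mem hM h0
      (fun k u h1 h2 i hi => ⟨(hP k u h1 h2 i hi).1, (hP k u h1 h2 i hi).2.1⟩) hx k
  let Q : ℕ → ℝ := fun k => ∏ i ∈ Finset.range k, (M i : ℝ)
  have hQs : ∀ k, Q (k + 1) = Q k * M k := fun k => Finset.prod_range_succ _ _
  have hM' : ∀ k, (2 : ℝ) ≤ M k := fun k => by exact_mod_cast hM k
  have hQtwo : ∀ k, (2 : ℝ) ^ k ≤ Q k := by
    intro k
    induction k with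
    | zero => simp [Q]
    | succ k ih =>
      rw [hQs, pow_succ]
      exact mul_le_mul ih (hM' k) (by norm_num) ((by positivity : (0 : ℝ) ≤ 2 ^ k).trans ih)
  have hQ0 : ∀ k, 0 < Q k := fun k => (by positivity : (0 : ℝ) < 2 ^ k).trans_le (hQtwo k)
  have hdig : ∀ x, 0 ≤ x → ∀ k, M k * ⌊x * Q k⌋₊ ≤ ⌊x * Q (k + 1)⌋₊ ∧
      ⌊x * Q (k + 1)⌋₊ < M k * ⌊x * Q k⌋₊ + M k := by
    intro x hx k
    rw [hQs, ← mul_assoc]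
    exact floor_mul_natCast (mul_nonneg hx (hQ0 k).le) (by have := hM k; omega)
  -- the point with code `x`
  let φ : ℝ → ℝ := fun x => ⨆ k, b x k
  have hmono : ∀ x, 0 ≤ x → Monotone (b x) := fun x hx =>
    monotone_nat_of_le_succ fun k => (hmem x hx k).2.2.1
  have hanti : ∀ x, 0 ≤ x → Antitone (fun k => b x k + δ k) := fun x hx =>
    antitone_nat_of_succ_le fun k => (hmem x hx k).2.2.2
  have hup : ∀ x, 0 ≤ x → ∀ k j, b x j ≤ b x k + δ k := by
    intro x hx k j
    rcases le_total j k with hjk | hjk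
    · have := hmono x hx hjk
      linarith [(hδ k).1]
    · have := hanti x hx hjk
      simp only at this
      linarith [(hδ j).1]
  have hφ : ∀ x, 0 ≤ x → ∀ k, b x k ≤ φ x ∧ φ x ≤ b x k + δ k := fun x hx k =>
    ⟨le_ciSup ⟨b x 0 + δ 0, by rintro _ ⟨j, rfl⟩; exact hup x hx 0 j⟩ k, ciSup_le (hup x hx k)⟩
  have hφE : ∀ x, 0 ≤ x → φ x ∈ Icc u₀ v₀ ∩ ⋂ N, E N := by
    intro x hx
    refine ⟨⟨(hφ x hx 0).1, (hφ x hx 0).2.trans h0⟩, mem_iInter.2 fun k => ?_⟩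
    have h1 := hmem x hx k
    refine (hP k (b x k) h1.1 h1.2.1 (⌊x * Q (k + 1)⌋₊ - M k * ⌊x * Q k⌋₊) ?_).2.2 (hφ x hx (k + 1))
    have := hdig x hx k
    omega
  -- up to a constant factor there are at least `δ k ^ (-d)` intervals of level `k`
  obtain ⟨A, hA0, hA⟩ : ∃ A : ℝ, 0 < A ∧ ∀ k, 2 ≤ A * (Q k * δ k ^ d) := by
    refine ⟨2 + 2 / δ 0 ^ d, ?_, fun k => ?_⟩
    · have := Real.rpow_pos_of_pos (hδ 0).1 d
      positivity
    rcases k with _ | k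
    · have := Real.rpow_pos_of_pos (hδ 0).1 d
      simp only [Q, Finset.range_zero, Finset.prod_empty, one_mul]
      rw [add_mul, div_mul_cancel₀ _ this.ne']
      linarith
    · have h1 := Real.rpow_pos_of_pos (hδ 0).1 d
      have h2 := Real.rpow_pos_of_pos (hδ (k + 1)).1 d
      have h3 : 1 ≤ Q (k + 1) * δ (k + 1) ^ d := by
        have h4 := hMd k
        rw [Real.rpow_neg (hδ (k + 1)).1.le, inv_le_iff_one_le_mul₀ h2] at h4
        have h5 : 1 ≤ Q k := (one_le_pow₀ (by norm_num : (1 : ℝ) ≤ 2)).trans (hQtwo k)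
        rw [hQs, mul_assoc]
        nlinarith
      have h6 : 0 ≤ 2 / δ 0 ^ d := by positivity
      nlinarith
  have hkey : ∀ x y, 0 ≤ x → x < y → y < 1 →
      φ x < φ y ∧ y - x ≤ A * C ^ d * (φ y - φ x) ^ d := by
    classical
    intro x y hx hxy hy1
    have hy : 0 ≤ y := hx.trans hxy.le
    have hex : ∃ k, ⌊x * Q k⌋₊ ≠ ⌊y * Q k⌋₊ := by
      obtain ⟨k, hk⟩ := pow_unbounded_of_one_lt (1 / (y - x)) (one_lt_two (α := ℝ))
      refine ⟨k, fun h => ?_⟩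
      have h1 := hk.trans_le (hQtwo k)
      rw [div_lt_iff₀ (by linarith)] at h1
      have h2 := Nat.floor_le (mul_nonneg hx (hQ0 k).le)
      have h3 := Nat.lt_floor_add_one (y * Q k)
      rw [← h] at h3
      nlinarith
    -- the first level at which the two branches separate
    obtain ⟨k, hk⟩ : ∃ k, Nat.find hex = k + 1 := by
      refine Nat.exists_eq_succ_of_ne_zero fun h0 => ?_
      have h1 := Nat.find_spec hex
      rw [h0] at h1
      simp only [Q, Finset.range_zero, Finset.prod_empty, mul_one] at h1
      rw [Nat.floor_eq_zero.2 hy1, Nat.floor_eq_zero.2 (hxy.trans hy1)] at h1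
      exact h1 rfl
    have heq : ∀ j ≤ k, ⌊x * Q j⌋₊ = ⌊y * Q j⌋₊ := fun j hj => by
      have := Nat.find_min hex (show j < Nat.find hex by omega)
      push Not at this
      exact this
    have hne : ⌊x * Q (k + 1)⌋₊ ≠ ⌊y * Q (k + 1)⌋₊ := by
      have := Nat.find_spec hex
      rwa [hk] at this
    have hlt : ⌊x * Q (k + 1)⌋₊ < ⌊y * Q (k + 1)⌋₊ := lt_of_le_of_ne
      (Nat.floor_le_floor (mul_le_mul_of_nonneg_right hxy.le (hQ0 _).le)) hne
    have hbk : b x k = b y k := branchPoint_congr heq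
    have hdx := hdig x hx k
    have hdy := hdig y hy k
    rw [heq k le_rfl] at hdx
    set i := ⌊x * Q (k + 1)⌋₊ - M k * ⌊y * Q k⌋₊ with hi
    set j := ⌊y * Q (k + 1)⌋₊ - M k * ⌊y * Q k⌋₊ with hj
    have hij : i < j := by omega
    have hjM : j < M k := by omega
    have hmx := hmem x hx k
    have hsp := hsep k (b x k) hmx.1 hmx.2.1 i j hij hjM
    have hbx : b x (k + 1) = p k (b x k) i := by
      rw [hi, ← heq k le_rfl]; rfl
    have hby : b y (k + 1) = p k (b x k) j := by rw [hbk]; rfl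
    have hφx := (hφ x hx (k + 1)).2
    have hφy := (hφ y hy (k + 1)).1
    rw [hbx] at hφx
    rw [hby] at hφy
    have hn1 : (1 : ℝ) ≤ (j : ℝ) - i := by
      have : (i : ℝ) + 1 ≤ j := by exact_mod_cast hij
      linarith
    have hnM : (j : ℝ) - i ≤ M k := by
      have h1 : (j : ℝ) ≤ M k := by exact_mod_cast hjM.le
      have h2 : (0 : ℝ) ≤ i := i.cast_nonneg
      linarith
    have hxyQ : (y - x) * Q (k + 1) ≤ 2 * ((j : ℝ) - i) := by
      have h1 := Nat.floor_le (mul_nonneg hx (hQ0 (k + 1)).le)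
      have h2 := Nat.lt_floor_add_one (y * Q (k + 1))
      have h3 : (⌊y * Q (k + 1)⌋₊ : ℝ) - ⌊x * Q (k + 1)⌋₊ = (j : ℝ) - i := by
        have : ⌊y * Q (k + 1)⌋₊ + i = ⌊x * Q (k + 1)⌋₊ + j := by omega
        have h4 : (⌊y * Q (k + 1)⌋₊ : ℝ) + i = ⌊x * Q (k + 1)⌋₊ + j := by exact_mod_cast this
        linarith
      linarith
    set n : ℝ := (j : ℝ) - i
    have hMk : (0 : ℝ) < M k := by linarith [hM' k]
    have hne0 : 0 < n * e k := mul_pos (by linarith) (he k)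
    have hφd : n * e k ≤ φ y - φ x := by linarith
    refine ⟨by linarith, ?_⟩
    have hMe0 : 0 < M k * e k := mul_pos hMk (he k)
    have s1 : δ k ^ d ≤ C ^ d * (M k * e k) ^ d := by
      rw [← Real.mul_rpow hC.le hMe0.le]
      exact Real.rpow_le_rpow (hδ k).1.le (hMe k) hd.le
    have s2 : n / M k * (M k * e k) ^ d ≤ (n * e k) ^ d := by
      have h1 : n * e k = n / M k * (M k * e k) := by field_simp
      have h2 : 0 < n / M k := div_pos (by linarith) hMk
      rw [h1, Real.mul_rpow h2.le hMe0.le]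
      refine mul_le_mul_of_nonneg_right ?_ (Real.rpow_nonneg hMe0.le _)
      have := Real.rpow_le_rpow_of_exponent_ge h2 (by rw [div_le_one hMk]; exact hnM) hd1.le
      rwa [Real.rpow_one] at this
    have s3 : (n * e k) ^ d ≤ (φ y - φ x) ^ d := Real.rpow_le_rpow hne0.le hφd hd.le
    have s4 : 2 ≤ A * C ^ d * (Q k * (M k * e k) ^ d) := by
      have := mul_le_mul_of_nonneg_left s1 (mul_pos hA0 (hQ0 k)).le
      linarith [hA k]
    have s5 : (y - x) * Q (k + 1) ≤ A * C ^ d * (φ y - φ x) ^ d * Q (k + 1) := by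
      have hACd : 0 < A * C ^ d := mul_pos hA0 (Real.rpow_pos_of_pos hC _)
      calc (y - x) * Q (k + 1) ≤ n * 2 := by linarith
        _ ≤ n * (A * C ^ d * (Q k * (M k * e k) ^ d)) :=
          mul_le_mul_of_nonneg_left s4 (by linarith)
        _ = A * C ^ d * (n / M k * (M k * e k) ^ d) * Q (k + 1) := by
          rw [hQs]; field_simp
        _ ≤ _ := mul_le_mul_of_nonneg_right
          (mul_le_mul_of_nonneg_left (s2.trans s3) hACd.le) (hQ0 _).le
    exact le_of_mul_le_mul_right s5 (hQ0 _)
  have hkey' : ∀ x ∈ Ico (0 : ℝ) 1, ∀ y ∈ Ico (0 : ℝ) 1,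
      |x - y| ≤ A * C ^ d * |φ x - φ y| ^ d := by
    intro x hx y hy
    rcases lt_trichotomy x y with h | h | h
    · obtain ⟨h1, h2⟩ := hkey x y hx.1 h hy.2
      rw [abs_sub_comm, abs_sub_comm (φ x), abs_of_pos (by linarith), abs_of_pos (by linarith)]
      exact h2
    · subst h
      simp [Real.zero_rpow hd.ne']
    · obtain ⟨h1, h2⟩ := hkey y x hy.1 h hx.2
      rw [abs_of_pos (by linarith), abs_of_pos (by linarith)]
      exact h2
  have hinj : InjOn φ (Ico 0 1) := by
    intro x hx y hy hxy
    have := hkey' x hx y hy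
    rw [hxy, sub_self, abs_zero, Real.zero_rpow hd.ne', mul_zero] at this
    exact sub_eq_zero.1 (abs_nonpos_iff.1 this)
  have hACd : 0 ≤ A * C ^ d := (mul_pos hA0 (Real.rpow_pos_of_pos hC _)).le
  have hhold : HolderOnWith (A * C ^ d).toNNReal d.toNNReal (Function.invFunOn φ (Ico 0 1))
      (φ '' Ico 0 1) := by
    rintro _ ⟨x, hx, rfl⟩ _ ⟨y, hy, rfl⟩
    rw [hinj.leftInvOn_invFunOn hx, hinj.leftInvOn_invFunOn hy, edist_dist, edist_dist,
      Real.coe_toNNReal d hd.le, ENNReal.ofReal_rpow_of_nonneg dist_nonneg hd.le,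
      ← ENNReal.ofReal, ← ENNReal.ofReal_mul hACd]
    exact ENNReal.ofReal_le_ofReal (hkey' x hx y hy)
  have hdim := hhold.dimH_image_le (Real.toNNReal_pos.2 hd)
  rw [hinj.invFunOn_image Subset.rfl, Real.dimH_of_nonempty_interior
    (by rw [interior_Ico]; exact nonempty_Ioo.2 one_pos), Module.finrank_self, Nat.cast_one,
    ENNReal.le_div_iff_mul_le (Or.inl (by simpa using hd)) (Or.inl ENNReal.coe_ne_top),
    one_mul] at hdim
  refine hdim.trans (dimH_mono ?_)
  rintro _ ⟨x, hx, rfl⟩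
  exact hφE x hx.1

/-! ### Neighbourhoods of evenly spaced points -/

theorem tendsto_natCast_rpow_zero {x : ℝ} (hx : x < 0) (c : ℝ) :
    Tendsto (fun K : ℕ => c * (K : ℝ) ^ x) atTop (𝓝 0) := by
  have := (tendsto_rpow_neg_atTop (neg_pos.2 hx)).comp (tendsto_natCast_atTop_atTop (R := ℝ))
  simp only [neg_neg] at this
  simpa using this.const_mul c

/-- A lower bound for the dimension of a limsup set around the solutions `α` of `Y α ∈ ℤ / K ^ g`,
where `Y` is a bi-Lipschitz function: such points are evenly spaced with gaps of order `K ^ (-g)`,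
and the set contains intervals of length `K ^ (-ω)` that begin at them. -/
theorem le_dimH_of_lattice_points {E : ℕ → Set ℝ} {u₀ v₀ d ω lam L : ℝ} {g : ℕ} {Y : ℝ → ℝ}
    (huv : u₀ < v₀) (hd : 0 < d) (hd1 : d < 1) (hg : 0 < g) (hgω : g < ω) (hωd : ω * d < g)
    (hlam : 0 < lam) (hL : 0 < L)
    (hY : ∀ u v, u₀ ≤ u → u ≤ v → v ≤ v₀ → lam * (v - u) ≤ Y v - Y u ∧ Y v - Y u ≤ L * (v - u))
    (hE : ∀ N, ∀ᶠ K : ℕ in atTop, ∀ α ∈ Icc u₀ v₀, ∀ z : ℤ, Y α * (K : ℝ) ^ g = z →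
      Icc α (α + (K : ℝ) ^ (-ω)) ⊆ E N) :
    ENNReal.ofReal d ≤ dimH (Icc u₀ v₀ ∩ ⋂ N, E N) := by
  have hg' : (0 : ℝ) < g := by exact_mod_cast hg
  have hYc : ContinuousOn Y (Icc u₀ v₀) := by
    refine (LipschitzOnWith.of_dist_le_mul (K := L.toNNReal) fun x hx y hy => ?_).continuousOn
    rw [Real.coe_toNNReal L hL.le, Real.dist_eq, Real.dist_eq]
    rcases le_total x y with h | h
    · obtain ⟨h1, h2⟩ := hY x y hx.1 h hy.2
      have h3 : 0 ≤ lam * (y - x) := mul_nonneg hlam.le (by linarith)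
      rw [abs_sub_comm, abs_sub_comm x, abs_of_nonneg (by linarith), abs_of_nonneg (by linarith)]
      exact h2
    · obtain ⟨h1, h2⟩ := hY y x hy.1 h hx.2
      have h3 : 0 ≤ lam * (x - y) := mul_nonneg hlam.le (by linarith)
      rw [abs_of_nonneg (by linarith), abs_of_nonneg (by linarith)]
      exact h2
  -- only the first half of each parent interval is filled, so that the children fit into it
  set C : ℝ := 2 / lam with hC
  have hC0 : 0 < C := by positivity
  refine le_dimH_of_branching (C := 4 * C * L) huv hd hd1 (by positivity) fun δ hδ hδle N => ?_
  have hsmall : ∀ x : ℝ, x < 0 → ∀ c η : ℝ, 0 < η → ∀ᶠ K : ℕ in atTop, c * (K : ℝ) ^ x < η :=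
    fun x hx c η hη => (tendsto_natCast_rpow_zero hx c).eventually_lt_const hη
  obtain ⟨K, hK, hK0, e1, e2, e3, e4⟩ := ((hE N).and ((eventually_gt_atTop 0).and
    ((hsmall (-ω) (by linarith) 1 (δ / 2) (by positivity)).and
    ((hsmall (ω * d - g) (by linarith) (2 * C / δ) 1 one_pos).and
    ((hsmall (-g) (by linarith) (2 * C / δ) 1 one_pos).and
    (hsmall (g - ω) (by linarith) (2 * L) 1 one_pos)))))).exists
  have hK' : (0 : ℝ) < K := by exact_mod_cast hK0
  set q : ℝ := (K : ℝ) ^ g with hq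
  have hq0 : 0 < q := by positivity
  have hqr : (K : ℝ) ^ (g : ℝ) = q := Real.rpow_natCast _ _
  set δ' : ℝ := (K : ℝ) ^ (-ω) with hδ'
  have hδ'0 : 0 < δ' := Real.rpow_pos_of_pos hK' _
  rw [one_mul] at e1
  rw [Real.rpow_sub hK', hqr, ← mul_div_assoc, div_lt_one hq0, div_mul_eq_mul_div,
    div_lt_iff₀ hδ] at e2
  rw [Real.rpow_neg hK'.le, hqr, ← div_eq_mul_inv, div_lt_one hq0, div_lt_iff₀ hδ] at e3
  rw [sub_eq_add_neg, Real.rpow_add hK', hqr] at e4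
  set M : ℕ := ⌊δ * q / C⌋₊ with hM
  have hM1 : (M : ℝ) ≤ δ * q / C := Nat.floor_le (by positivity)
  have hM2 : δ * q / C < M + 1 := Nat.lt_floor_add_one _
  have h2 : 2 ≤ δ * q / C := by rw [le_div_iff₀ hC0]; linarith
  have hMhalf : δ * q / (2 * C) ≤ M := by
    have : δ * q / (2 * C) = δ * q / C / 2 := by field_simp
    rw [this]; linarith
  refine ⟨δ', M, 1 / (2 * q * L), hδ'0, by linarith, Nat.le_floor (by exact_mod_cast h2),
    by positivity, ?_, ?_, fun u hu hu' => ?_⟩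
  · refine le_trans ?_ hMhalf
    rw [hδ', ← Real.rpow_mul hK'.le, neg_mul_neg, le_div_iff₀ (by positivity)]
    linarith
  · have := mul_le_mul_of_nonneg_left hMhalf (show 0 ≤ 4 * C * L * (1 / (2 * q * L)) by positivity)
    calc δ = 4 * C * L * (1 / (2 * q * L)) * (δ * q / (2 * C)) := by field_simp; norm_num
      _ ≤ _ := this
      _ = _ := by ring
  · have hval : ∀ i < M, ∃ x ∈ Icc u (u + δ), Y x * q = (⌈Y u * q⌉ + i : ℤ) := by
      intro i hi
      have hi' : (i : ℝ) + 1 ≤ M := by exact_mod_cast hi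
      have h3 := Int.le_ceil (Y u * q)
      have h4 := Int.ceil_lt_add_one (Y u * q)
      have h5 := (hY u (u + δ) hu (by linarith) hu').1
      have h6 : (M : ℝ) ≤ lam * δ * q := by
        refine hM1.trans ?_
        rw [hC, div_div_eq_mul_div, div_le_iff₀ two_pos]
        have : 0 < δ * q * lam := by positivity
        linarith
      have h7 : (0 : ℝ) ≤ i := i.cast_nonneg
      have := intermediate_value_Icc (show u ≤ u + δ by linarith)
        (hYc.mono (Icc_subset_Icc hu hu'))
      obtain ⟨x, hx, hxe⟩ := this (show ((⌈Y u * q⌉ + i : ℤ) : ℝ) / q ∈ _ by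
        push_cast
        constructor
        · rw [le_div_iff₀ hq0]; linarith
        · rw [div_le_iff₀ hq0]
          have := mul_le_mul_of_nonneg_right h5 hq0.le
          rw [add_sub_cancel_left] at this
          linarith)
      exact ⟨x, hx, by rw [hxe]; field_simp⟩
    choose! P hPmem hPval using hval
    refine ⟨P, fun i hi => ⟨(hPmem i hi).1, ?_, ?_⟩, fun i j hij hj => ?_⟩
    · have h3 := Int.ceil_lt_add_one (Y u * q)
      have h4 := (hY u (P i) hu (hPmem i hi).1 ((hPmem i hi).2.trans hu')).1
      have h5 := hPval i hi
      have hi' : (i : ℝ) + 1 ≤ M := by exact_mod_cast hi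
      push_cast at h5
      have h6 := mul_le_mul_of_nonneg_right h4 hq0.le
      have h7 : lam * (P i - u) * q ≤ δ * q / C := by linarith
      rw [hC, div_div_eq_mul_div, le_div_iff₀ two_pos] at h7
      have h8 : 0 < lam * q := by positivity
      have h9 : (P i - u) * 2 ≤ δ := by
        refine le_of_mul_le_mul_left ?_ h8
        linarith
      linarith
    · exact hK (P i) ⟨hu.trans (hPmem i hi).1, (hPmem i hi).2.trans hu'⟩ _ (hPval i hi)
    · have hi : i < M := hij.trans hj
      have h3 := hPval i hi
      have h4 := hPval j hj
      push_cast at h3 h4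
      have hij' : (i : ℝ) + 1 ≤ j := by exact_mod_cast hij
      have h5 : (Y (P j) - Y (P i)) * q = j - i := by linarith
      have h6 : P i ≤ P j := by
        by_contra! hlt
        have h7 := (hY (P j) (P i) (hu.trans (hPmem j hj).1) hlt.le
          ((hPmem i hi).2.trans hu')).1
        have h8 : 0 < lam * (P i - P j) := mul_pos hlam (by linarith)
        nlinarith
      have h7 := (hY (P i) (P j) (hu.trans (hPmem i hi).1) h6 ((hPmem j hj).2.trans hu')).2
      have h8 := mul_le_mul_of_nonneg_right h7 hq0.le
      rw [h5] at h8
      have h9 : δ' * (2 * q * L) ≤ (j : ℝ) - i := by linarith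
      rw [mul_one_div, div_le_iff₀ (by positivity)]
      linarith

/-! ### Drifting sequences modulo one -/

/-- `x` lies in the open interval `(p, p + w)` modulo `1`. -/
def InArc (p w x : ℝ) : Prop := ∃ z : ℤ, p < x - z ∧ x - z < p + w

/-- Write a sequence with small positive steps modulo `1` as the sum of a real sequence with the
same small steps and an integer sequence. -/
theorem exists_lift {f : ℕ → ℝ} {A B : ℝ} {N : ℕ}
    (h : ∀ n < N, ∃ z : ℤ, A ≤ f (n + 1) - f n - z ∧ f (n + 1) - f n - z ≤ B) :
    ∃ e : ℕ → ℤ, e 0 = 0 ∧ ∀ n < N, A ≤ (f (n + 1) - e (n + 1)) - (f n - e n) ∧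
      (f (n + 1) - e (n + 1)) - (f n - e n) ≤ B := by
  choose! z hz using h
  refine ⟨fun n => ∑ i ∈ Finset.range n, z i, by simp, fun n hn => ?_⟩
  have := hz n hn
  simp only [Finset.sum_range_succ]
  push_cast
  constructor <;> linarith [this.1, this.2]

theorem drift_bounds {g : ℕ → ℝ} {A B : ℝ} {N : ℕ}
    (h : ∀ n < N, A ≤ g (n + 1) - g n ∧ g (n + 1) - g n ≤ B) (m j : ℕ) (hmj : m + j ≤ N) :
    j * A ≤ g (m + j) - g m ∧ g (m + j) - g m ≤ j * B := by
  induction j with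
  | zero => simp
  | succ j ih =>
    obtain ⟨h1, h2⟩ := ih (by omega)
    obtain ⟨h3, h4⟩ := h (m + j) (by omega)
    rw [← add_assoc m j 1]
    push_cast
    constructor <;> linarith

/-- An increasing sequence cannot jump over an interval that is longer than its steps. -/
theorem exists_mem_arc {g : ℕ → ℝ} {A B p w : ℝ} {m N L : ℕ}
    (h : ∀ n < L, A ≤ g (n + 1) - g n ∧ g (n + 1) - g n ≤ B) (hL : m + N ≤ L)
    (hB : B < w) (hN : 1 ≤ N * A) :
    ∃ n ≤ N, InArc p w (g (m + n)) := by
  classical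
  set z : ℤ := ⌈g m - p⌉ with hz
  have hz1 : g m - p ≤ z := Int.le_ceil _
  have hz2 : (z : ℝ) < g m - p + 1 := Int.ceil_lt_add_one _
  have hex : ∃ n, p + z < g (m + n) := by
    refine ⟨N, ?_⟩
    have := (drift_bounds h m N hL).1
    linarith
  have hle : Nat.find hex ≤ N := Nat.find_min' hex (by
    have := (drift_bounds h m N hL).1
    linarith)
  refine ⟨Nat.find hex, hle, z, ?_, ?_⟩
  · linarith [Nat.find_spec hex]
  · obtain ⟨k, hk⟩ : ∃ k, Nat.find hex = k + 1 := by
      refine Nat.exists_eq_succ_of_ne_zero fun h0 => ?_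
      have := Nat.find_spec hex
      rw [h0, add_zero] at this
      linarith
    have h1 := Nat.find_min hex (show k < Nat.find hex by omega)
    have h2 := (h (m + k) (by omega)).2
    rw [hk, ← add_assoc]
    linarith

/-- Two sequences whose steps modulo `1` are positive and small, the second one moving much slower
than the first, enter a prescribed box modulo `1` together and stay there for `J` more steps. -/
theorem exists_stay_in_box {f₁ f₂ : ℕ → ℝ} {A₁ B₁ A₂ B₂ p₁ p₂ W : ℝ} {N₁ N₂ J : ℕ}
    (h₁ : ∀ n < N₂ + N₁ + J, ∃ z : ℤ, A₁ ≤ f₁ (n + 1) - f₁ n - z ∧ f₁ (n + 1) - f₁ n - z ≤ B₁)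
    (h₂ : ∀ n < N₂ + N₁ + J, ∃ z : ℤ, A₂ ≤ f₂ (n + 1) - f₂ n - z ∧ f₂ (n + 1) - f₂ n - z ≤ B₂)
    (hA₁ : 0 < A₁) (hA₂ : 0 < A₂) (hAB₁ : A₁ ≤ B₁) (hAB₂ : A₂ ≤ B₂)
    (hN₁ : 1 ≤ N₁ * A₁) (hN₂ : 1 ≤ N₂ * A₂)
    (hB₁ : (J + 1) * B₁ < W / 2) (hB₂ : (N₁ + J + 1) * B₂ < W / 2) :
    ∃ n₀ ≤ N₂ + N₁, ∀ j ≤ J, InArc p₁ W (f₁ (n₀ + j)) ∧ InArc p₂ W (f₂ (n₀ + j)) := by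
  obtain ⟨e₁, -, he₁⟩ := exists_lift h₁
  obtain ⟨e₂, -, he₂⟩ := exists_lift h₂
  have hJ : (0 : ℝ) ≤ J := J.cast_nonneg
  have hN : (0 : ℝ) ≤ N₁ := N₁.cast_nonneg
  have hB₁0 : 0 < B₁ := hA₁.trans_le hAB₁
  have hB₂0 : 0 < B₂ := hA₂.trans_le hAB₂
  obtain ⟨n₂, hn₂, z₂, hz₂, hz₂'⟩ := exists_mem_arc (g := fun n => f₂ n - e₂ n) (p := p₂)
    (w := W / 2) (m := 0) (N := N₂) he₂ (by omega) (by nlinarith) hN₂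
  obtain ⟨n₁, hn₁, z₁, hz₁, hz₁'⟩ := exists_mem_arc (g := fun n => f₁ n - e₁ n) (p := p₁)
    (w := W / 2) (m := n₂) (N := N₁) he₁ (by omega) (by nlinarith) hN₁
  refine ⟨n₂ + n₁, by omega, fun j hj => ⟨?_, ?_⟩⟩
  · have hd := drift_bounds (g := fun n => f₁ n - e₁ n) he₁ (n₂ + n₁) j (by omega)
    have hj' : (j : ℝ) ≤ J := by exact_mod_cast hj
    have hj0 : (0 : ℝ) ≤ j := j.cast_nonneg
    refine ⟨z₁ + e₁ (n₂ + n₁ + j), ?_, ?_⟩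
    · push_cast
      nlinarith [hd.1]
    · push_cast
      nlinarith [hd.2]
  · have hd := drift_bounds (g := fun n => f₂ n - e₂ n) he₂ n₂ (n₁ + j) (by omega)
    have hj' : ((n₁ + j : ℕ) : ℝ) ≤ N₁ + J := by exact_mod_cast (by omega : n₁ + j ≤ N₁ + J)
    have hj0 : (0 : ℝ) ≤ ((n₁ + j : ℕ) : ℝ) := Nat.cast_nonneg _
    rw [zero_add] at hz₂ hz₂'
    rw [← add_assoc] at hd
    refine ⟨z₂ + e₂ (n₂ + n₁ + j), ?_, ?_⟩
    · push_cast
      nlinarith [hd.1]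
    · push_cast
      nlinarith [hd.2]

theorem iterate_fwdDiff_shift (f : ℕ → ℝ) (r m n : ℕ) :
    (fwdDiff 1)^[r] (fun k => f (m + k)) n = (fwdDiff 1)^[r] f (m + n) := by
  induction r generalizing n with
  | zero => simp
  | succ r ih =>
    rw [Function.iterate_succ_apply', Function.iterate_succ_apply', fwdDiff, fwdDiff, ih, ih,
      add_assoc]

/-- If the `R`-th differences of two sequences stay for long enough in a suitable small box modulo
`1`, then the sequences themselves visit a given box together. The induction on `R` uses that small
`(R + 1)`-st differences let the `R`-th differences drift into the box prescribed for them. -/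
theorem exists_box_of_iterate_fwdDiff (p₁ p₂ : ℝ) {w : ℝ} (hw : 0 < w) (R : ℕ) :
    ∃ P₁ P₂ W : ℝ, 0 < W ∧ ∃ J : ℕ, ∀ f₁ f₂ : ℕ → ℝ,
      (∀ n ≤ J, InArc P₁ W ((fwdDiff 1)^[R] f₁ n) ∧ InArc P₂ W ((fwdDiff 1)^[R] f₂ n)) →
      ∃ n ≤ J, InArc p₁ w (f₁ n) ∧ InArc p₂ w (f₂ n) := by
  induction R with
  | zero => exact ⟨p₁, p₂, w, hw, 0, fun f₁ f₂ h => ⟨0, le_rfl, h 0 le_rfl⟩⟩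
  | succ R ih =>
    obtain ⟨P₁, P₂, W, hW, J, hJ⟩ := ih
    have hJ0 : (0 : ℝ) ≤ J := J.cast_nonneg
    obtain ⟨η, hη, hηW⟩ : ∃ η : ℝ, 0 < η ∧ (J + 1) * (2 * η) < W / 2 := by
      refine ⟨W / (8 * (J + 1)), by positivity, ?_⟩
      have : (J + 1) * (2 * (W / (8 * (J + 1)))) = W / 4 := by field_simp; norm_num
      rw [this]; linarith
    obtain ⟨N₁, hN₁⟩ := exists_nat_ge (1 / η)
    have hN0 : (0 : ℝ) ≤ N₁ := N₁.cast_nonneg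
    obtain ⟨η', hη', hη'W, hle⟩ : ∃ η' : ℝ, 0 < η' ∧ (N₁ + J + 1) * (2 * η') < W / 2 ∧ η' ≤ η := by
      refine ⟨min η (W / (8 * (N₁ + J + 1))), by positivity, ?_, min_le_left _ _⟩
      have : (N₁ + J + 1) * (2 * (W / (8 * (N₁ + J + 1)))) = W / 4 := by field_simp; norm_num
      have h2 : (N₁ + J + 1) * (2 * min η (W / (8 * (N₁ + J + 1)))) ≤
        (N₁ + J + 1) * (2 * (W / (8 * (N₁ + J + 1)))) := by
        gcongr
        exact min_le_right _ _
      linarith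
    obtain ⟨N₂, hN₂⟩ := exists_nat_ge (1 / η')
    rw [div_le_iff₀ hη] at hN₁
    rw [div_le_iff₀ hη'] at hN₂
    refine ⟨η, η', η', hη', N₂ + N₁ + J, fun f₁ f₂ h => ?_⟩
    simp only [Function.iterate_succ_apply'] at h
    obtain ⟨n₀, hn₀, hbox⟩ := exists_stay_in_box (f₁ := (fwdDiff 1)^[R] f₁)
      (f₂ := (fwdDiff 1)^[R] f₂) (A₁ := η) (B₁ := 2 * η) (A₂ := η') (B₂ := 2 * η') (p₁ := P₁)
      (p₂ := P₂) (W := W) (N₁ := N₁) (N₂ := N₂) (J := J)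
      (fun n hn => by
        obtain ⟨z, hz, hz'⟩ := (h n hn.le).1
        exact ⟨z, hz.le, by simp only [fwdDiff] at hz'; linarith⟩)
      (fun n hn => by
        obtain ⟨z, hz, hz'⟩ := (h n hn.le).2
        exact ⟨z, hz.le, by simp only [fwdDiff] at hz'; linarith⟩)
      hη hη' (by linarith) (by linarith) hN₁ hN₂ hηW hη'W
    obtain ⟨n, hn, hhit⟩ := hJ (fun k => f₁ (n₀ + k)) (fun k => f₂ (n₀ + k)) (fun n hn => by
      rw [iterate_fwdDiff_shift, iterate_fwdDiff_shift]
      exact hbox n hn)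
    exact ⟨n₀ + n, by omega, hhit⟩

/-- Mean value bounds for iterated differences: if `F (i + 1)` is the derivative of `F i` for all
`i`, then the `r`-th difference of `F 0` obeys the bounds of `F r`. -/
theorem iterate_fwdDiff_mem_Icc (r : ℕ) {F : ℕ → ℝ → ℝ} {A B : ℝ} {n : ℕ} (hn : 0 < n)
    (hF : ∀ i, ∀ x > 0, HasDerivAt (F i) (F (i + 1) x) x)
    (hAB : ∀ x : ℝ, n ≤ x → x ≤ n + r → F r x ∈ Icc A B) :
    (fwdDiff 1)^[r] (fun k : ℕ => F 0 k) n ∈ Icc A B := by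
  induction r generalizing F with
  | zero => exact hAB n le_rfl (by simp)
  | succ r ih =>
    have hn' : (0 : ℝ) < n := by exact_mod_cast hn
    have hG := @ih (fun i x => F i (x + 1) - F i x) (fun i x hx => by
      have h1 : HasDerivAt (fun x => F i (x + 1)) (F (i + 1) (x + 1)) x :=
        (hF i (x + 1) (by linarith)).comp_add_const x 1
      exact h1.sub (hF i x hx)) (fun x hx hx' => by
      obtain ⟨ξ, hξ, hξ'⟩ := exists_hasDerivAt_eq_slope (F r) (F (r + 1)) (show x < x + 1 by linarith)
        (fun y hy => (hF r y (by linarith [hy.1])).continuousAt.continuousWithinAt)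
        (fun y hy => hF r y (by linarith [hy.1]))
      rw [add_sub_cancel_left, div_one] at hξ'
      rw [← hξ']
      refine hAB ξ (by linarith [hξ.1]) ?_
      push_cast
      linarith [hξ.2])
    rw [Function.iterate_succ_apply]
    convert hG using 3
    simp [fwdDiff]

theorem hasDerivAt_rpow_iterate (T α : ℝ) (i : ℕ) {x : ℝ} (hx : 0 < x) :
    HasDerivAt (fun x => T * (∏ j ∈ Finset.range i, (α - j)) * x ^ (α - i))
      (T * (∏ j ∈ Finset.range (i + 1), (α - j)) * x ^ (α - (i + 1 : ℕ))) x := by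
  have h := (Real.hasDerivAt_rpow_const (x := x) (p := α - i) (Or.inl hx.ne')).const_mul
    (T * (∏ j ∈ Finset.range i, (α - j)))
  refine h.congr_deriv ?_
  rw [Finset.prod_range_succ]
  push_cast
  rw [sub_sub]
  ring

/-- If the `(R + 1)`-st differences of `T₁ k ^ α` and `T₂ k ^ α` near `k = K` are small, of very
different sizes, and large compared with `1 / K`, then some `k` of size `K` makes both numbers
lie in a prescribed arc modulo `1`. -/
theorem exists_rpow_inArc (R : ℕ) (P : ℝ) {w : ℝ} (hw : 0 < w) :
    ∃ W : ℝ, 0 < W ∧ W ≤ 1 ∧ ∀ (T₁ T₂ α : ℝ) (K : ℕ), 0 ≤ α → α ≤ R + 1 → 0 < K →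
      0 < T₁ * ∏ j ∈ Finset.range (R + 1), (α - j) →
      0 < T₂ * ∏ j ∈ Finset.range (R + 1), (α - j) →
      T₁ * (∏ j ∈ Finset.range (R + 1), (α - j)) * (K : ℝ) ^ (α - (R + 1)) ≤ W →
      T₂ * (∏ j ∈ Finset.range (R + 1), (α - j)) ≤
        W * (T₁ * ∏ j ∈ Finset.range (R + 1), (α - j)) →
      1 ≤ W * (T₂ * (∏ j ∈ Finset.range (R + 1), (α - j)) * (K : ℝ) ^ (α - R)) →
      ∃ k : ℕ, K ≤ k ∧ k ≤ 3 * K ∧ InArc P w (T₁ * (k : ℝ) ^ α) ∧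
        InArc P w (T₂ * (k : ℝ) ^ α) := by
  obtain ⟨P₁, P₂, W₀, hW₀, J, hJ⟩ := exists_box_of_iterate_fwdDiff P P hw R
  -- `D` bounds the ratio of two values of `x ^ (α - (R + 1))` on `[K, 3 K]`
  set D : ℝ := 3 ^ (R + 1) with hD
  have hD1 : 1 ≤ D := one_le_pow₀ (by norm_num)
  have hJ0 : (0 : ℝ) ≤ J := J.cast_nonneg
  have hR0 : (0 : ℝ) ≤ R := R.cast_nonneg
  set S : ℝ := D + J + R + 3 with hS
  have hS3 : 3 ≤ S := by linarith
  obtain ⟨W, hW, hW1, hWS, hWW⟩ : ∃ W : ℝ, 0 < W ∧ W ≤ 1 ∧ W * S ≤ 1 / 4 ∧ W * S < W₀ / 2 := by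
    refine ⟨min (1 / (4 * S)) (W₀ / (4 * S)), by positivity, ?_, ?_, ?_⟩
    · refine (min_le_left _ _).trans ?_
      rw [div_le_one (by positivity)]; linarith
    · refine (mul_le_mul_of_nonneg_right (min_le_left _ _) (by positivity)).trans_eq ?_
      field_simp
    · refine (mul_le_mul_of_nonneg_right (min_le_right _ _) (by positivity)).trans_lt ?_
      have : W₀ / (4 * S) * S = W₀ / 4 := by field_simp
      rw [this]; linarith
  refine ⟨W, hW, hW1, fun T₁ T₂ α K hα hαR hK h₁ h₂ ha hb hc => ?_⟩
  set κ := ∏ j ∈ Finset.range (R + 1), (α - j) with hκ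
  have hK0 : (0 : ℝ) < K := by exact_mod_cast hK
  set X : ℝ := (K : ℝ) ^ (α - (R + 1)) with hX
  have hX0 : 0 < X := Real.rpow_pos_of_pos hK0 _
  have hXK : (K : ℝ) ^ (α - R) = X * K := by
    rw [hX, ← Real.rpow_add_one hK0.ne']; congr 1; ring
  have hstep : ∀ T, 0 < T * κ → ∀ n : ℕ, n + R + 1 ≤ 2 * K →
      (fwdDiff 1)^[R + 1] (fun k : ℕ => T * ((K + k : ℕ) : ℝ) ^ α) n ∈
        Icc (T * κ * X / D) (T * κ * X) := by
    intro T hT n hn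
    rw [iterate_fwdDiff_shift (fun k : ℕ => T * (k : ℝ) ^ α)]
    have hn' : (n : ℝ) + R + 1 ≤ 2 * K := by exact_mod_cast hn
    have := iterate_fwdDiff_mem_Icc (R + 1) (F := fun i x =>
      T * (∏ j ∈ Finset.range i, (α - j)) * x ^ (α - i)) (n := K + n)
      (A := T * κ * X / D) (B := T * κ * X) (by omega)
      (fun i x hx => hasDerivAt_rpow_iterate T α i hx) (fun x hx hx' => by
        push_cast at hx hx' ⊢
        have hn0 : (0 : ℝ) ≤ n := n.cast_nonneg
        have hxK : (K : ℝ) ≤ x := by linarith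
        have hx3 : x ≤ 3 * K := by linarith
        have hx0 : 0 < x := hK0.trans_le hxK
        have e0 : α - (R + 1) ≤ 0 := by linarith
        constructor
        · rw [mul_div_assoc]
          refine mul_le_mul_of_nonneg_left ?_ hT.le
          calc X / D ≤ (3 * K : ℝ) ^ (α - (R + 1)) := by
                rw [Real.mul_rpow (by norm_num) hK0.le, div_eq_mul_inv, mul_comm]
                refine mul_le_mul_of_nonneg_right ?_ hX0.le
                rw [hD, ← Real.rpow_natCast, ← Real.rpow_neg (by norm_num)]
                refine Real.rpow_le_rpow_of_exponent_le (by norm_num) ?_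
                push_cast; linarith
            _ ≤ x ^ (α - (R + 1)) := Real.rpow_le_rpow_of_nonpos hx0 hx3 e0
        · exact mul_le_mul_of_nonneg_left (Real.rpow_le_rpow_of_nonpos hK0 hxK e0) hT.le)
    simpa using this
  set B₁ := T₁ * κ * X with hB₁
  set B₂ := T₂ * κ * X with hB₂
  have hB₁0 : 0 < B₁ := by positivity
  have hB₂0 : 0 < B₂ := by positivity
  have hB₂₁ : B₂ ≤ W * B₁ := by
    rw [hB₁, hB₂, ← mul_assoc]; exact mul_le_mul_of_nonneg_right hb hX0.le
  have hB₂₁' : B₂ ≤ B₁ := hB₂₁.trans (mul_le_of_le_one_left hB₁0.le hW1)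
  have hdrift : 1 ≤ W * (B₂ * K) := by rw [hXK] at hc; rw [hB₂, mul_assoc (T₂ * κ)]; exact hc
  have hB₂W : B₂ ≤ W := hB₂₁'.trans ha
  have hWK : 1 ≤ W * K := by
    refine hdrift.trans (mul_le_mul_of_nonneg_left ?_ hW.le)
    exact mul_le_of_le_one_left hK0.le (hB₂W.trans hW1)
  have hceil : ∀ B, 0 < B → B₂ ≤ B → 1 ≤ (⌈D / B⌉₊ : ℝ) * (B / D) ∧ (⌈D / B⌉₊ : ℝ) < D / B + 1 ∧
      D / B ≤ D * (W * K) := by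
    intro B hB hBB
    refine ⟨?_, Nat.ceil_lt_add_one (by positivity), ?_⟩
    · have := Nat.le_ceil (D / B)
      calc (1 : ℝ) = D / B * (B / D) := by field_simp
        _ ≤ _ := mul_le_mul_of_nonneg_right this (by positivity)
    · rw [div_le_iff₀ hB]
      have h1 : W * K * B₂ ≤ W * K * B := mul_le_mul_of_nonneg_left hBB (by positivity)
      have h2 : 1 ≤ W * K * B := by linarith
      have h3 := mul_le_mul_of_nonneg_left h2 (zero_le_one.trans hD1)
      linarith
  obtain ⟨hN₁, hN₁', hN₁K⟩ := hceil B₁ hB₁0 hB₂₁'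
  obtain ⟨hN₂, hN₂', hN₂K⟩ := hceil B₂ hB₂0 le_rfl
  set N₁ := ⌈D / B₁⌉₊
  set N₂ := ⌈D / B₂⌉₊
  have hlen : N₂ + N₁ + J + R + 1 ≤ 2 * K := by
    have : (N₂ : ℝ) + N₁ + J + R + 1 ≤ 2 * K := by
      have e1 : (N₂ : ℝ) + N₁ + J + R + 1 ≤ 2 * (S * (W * K)) := by
        have : (J : ℝ) + R + 3 ≤ (J + R + 3) * (W * K) :=
          le_mul_of_one_le_right (by positivity) hWK
        have h2 : 0 ≤ (J + R + 3) * (W * K) := by positivity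
        rw [hS]; linarith
      have := mul_le_mul_of_nonneg_right hWS hK0.le
      linarith
    exact_mod_cast this
  have hDB : B₂ * (D / B₁) ≤ W * D := by
    rw [← mul_div_assoc, div_le_iff₀ hB₁0]
    have := mul_le_mul_of_nonneg_left hB₂₁ (zero_le_one.trans hD1)
    linarith
  obtain ⟨n₀, hn₀, hbox⟩ := exists_stay_in_box
    (f₁ := (fwdDiff 1)^[R] (fun k : ℕ => T₁ * ((K + k : ℕ) : ℝ) ^ α))
    (f₂ := (fwdDiff 1)^[R] (fun k : ℕ => T₂ * ((K + k : ℕ) : ℝ) ^ α))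
    (A₁ := B₁ / D) (B₁ := B₁) (A₂ := B₂ / D) (B₂ := B₂) (p₁ := P₁) (p₂ := P₂) (W := W₀)
    (N₁ := N₁) (N₂ := N₂) (J := J)
    (fun n hn => ⟨0, by
      have := hstep T₁ h₁ n (by omega)
      rw [Function.iterate_succ_apply'] at this
      simpa [fwdDiff] using this⟩)
    (fun n hn => ⟨0, by
      have := hstep T₂ h₂ n (by omega)
      rw [Function.iterate_succ_apply'] at this
      simpa [fwdDiff] using this⟩)
    (by positivity) (by positivity) (div_le_self hB₁0.le hD1) (div_le_self hB₂0.le hD1) hN₁ hN₂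
    (by
      have : (J + 1) * B₁ ≤ S * W := mul_le_mul (by linarith) ha hB₁0.le (by linarith)
      linarith)
    (by
      have e1 : (N₁ + J + 1) * B₂ ≤ (D / B₁ + 1 + J + 1) * B₂ :=
        mul_le_mul_of_nonneg_right (by linarith) hB₂0.le
      have e2 : (J + 2) * B₂ ≤ (J + 2) * W := mul_le_mul_of_nonneg_left hB₂W (by linarith)
      have e3 : (J + 2 + D) * W ≤ S * W := mul_le_mul_of_nonneg_right (by linarith) hW.le
      linarith)
  obtain ⟨n, hn, hhit₁, hhit₂⟩ := hJ (fun k => T₁ * ((K + (n₀ + k) : ℕ) : ℝ) ^ α)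
    (fun k => T₂ * ((K + (n₀ + k) : ℕ) : ℝ) ^ α) (fun n hn => by
      rw [iterate_fwdDiff_shift (fun k : ℕ => T₁ * ((K + k : ℕ) : ℝ) ^ α),
        iterate_fwdDiff_shift (fun k : ℕ => T₂ * ((K + k : ℕ) : ℝ) ^ α)]
      exact hbox n hn)
  exact ⟨K + (n₀ + n), by omega, by omega, hhit₁, hhit₂⟩

/-! ### Integer parts of powers -/

/-- The exponents `α` for which `a ⌊l ^ α⌋ + b ⌊m ^ α⌋ = c ⌊n ^ α⌋` for some distinct positive
integers `l`, `m`, `n` with `N ≤ n`. -/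
def solvableAbove (a b c N : ℕ) : Set ℝ :=
  {α | ∃ l m n : ℕ, 0 < l ∧ 0 < m ∧ 0 < n ∧ N ≤ n ∧ l ≠ m ∧ l ≠ n ∧ m ≠ n ∧
    a * ⌊(l : ℝ) ^ α⌋₊ + b * ⌊(m : ℝ) ^ α⌋₊ = c * ⌊(n : ℝ) ^ α⌋₊}

theorem floor_rpow_lt {α : ℝ} (hα : 1 ≤ α) {l m : ℕ} (h : l < m) :
    ⌊(l : ℝ) ^ α⌋₊ < ⌊(m : ℝ) ^ α⌋₊ := by
  refine Nat.lt_of_succ_le (Nat.le_floor ?_)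
  have h1 := Nat.floor_le (Real.rpow_nonneg (l.cast_nonneg : (0 : ℝ) ≤ l) α)
  have h2 := Real.add_rpow_le_rpow_add (a := (l : ℝ)) (b := 1) l.cast_nonneg zero_le_one hα
  rw [Real.one_rpow] at h2
  have h3 : ((l : ℝ) + 1) ^ α ≤ (m : ℝ) ^ α :=
    Real.rpow_le_rpow (by positivity) (by exact_mod_cast h) (by linarith)
  push_cast
  linarith

theorem floor_rpow_ne {α : ℝ} (hα : 1 ≤ α) {l m : ℕ} (h : l ≠ m) :
    ⌊(l : ℝ) ^ α⌋₊ ≠ ⌊(m : ℝ) ^ α⌋₊ := by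
  rcases lt_or_gt_of_ne h with h | h
  · exact (floor_rpow_lt hα h).ne
  · exact (floor_rpow_lt hα h).ne'

theorem isSolvableIn_of_mem_iInter {a b c : ℕ} {α : ℝ} (hα : 1 ≤ α)
    (h : α ∈ ⋂ N, solvableAbove a b c N) : IsSolvableIn a b c (piatetskiShapiro α) := by
  refine Set.Infinite.of_image (fun p => p.2.2) (Set.infinite_of_forall_exists_gt fun N => ?_)
  obtain ⟨l, m, n, hl, hm, hn, hNn, hlm, hln, hmn, heq⟩ := mem_iInter.1 h (N + 1)
  refine ⟨_, ⟨(⌊(l : ℝ) ^ α⌋₊, ⌊(m : ℝ) ^ α⌋₊, ⌊(n : ℝ) ^ α⌋₊), ⟨⟨l, hl, rfl⟩, ⟨m, hm, rfl⟩,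
    ⟨n, hn, rfl⟩, floor_rpow_ne hα hlm, floor_rpow_ne hα hln, floor_rpow_ne hα hmn, heq⟩, rfl⟩, ?_⟩
  refine (Nat.lt_of_succ_le hNn).trans_le (Nat.le_floor ?_)
  have hn1 : (1 : ℝ) ≤ n := by exact_mod_cast hn
  simpa using Real.rpow_le_rpow_of_exponent_le hn1 hα

theorem floor_eq_of_inArc {c : ℕ} (hc : 0 < c) {w x x' : ℝ} (hx : 0 ≤ x) (hw : c * w ≤ 1 / 2)
    (h : InArc 0 w (x / c)) (hxx' : x ≤ x') (hx' : x' - x < 1 / 2) :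
    ∃ U : ℕ, ⌊x'⌋₊ = c * U ∧ c * U < x ∧ x < c * U + c * w := by
  obtain ⟨z, hz1, hz2⟩ := h
  have hc' : (1 : ℝ) ≤ c := by exact_mod_cast hc
  have hc0 : (0 : ℝ) < c := by linarith
  rw [zero_add] at hz2
  have h1 : c * z < x := by
    have := mul_lt_mul_of_pos_left hz1 hc0
    rw [mul_sub, mul_div_cancel₀ _ hc0.ne'] at this
    linarith
  have h2 : x < c * z + c * w := by
    have := mul_lt_mul_of_pos_left hz2 hc0
    rw [mul_sub, mul_div_cancel₀ _ hc0.ne'] at this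
    linarith
  have hz0 : 0 ≤ z := by
    by_contra! hneg
    have : (z : ℝ) ≤ -1 := by exact_mod_cast Int.le_sub_one_of_lt hneg
    nlinarith
  lift z to ℕ using hz0
  rw [Int.cast_natCast] at h1 h2
  refine ⟨z, ?_, h1, h2⟩
  rw [Nat.floor_eq_iff (hx.trans hxx')]
  push_cast
  constructor <;> linarith

/-- If `a x + b y = c z` holds for real numbers such that `x / c` and `y / c` are slightly larger
than integers, then the equation holds for the integer parts, also after a slight increase of
`x`, `y` and `z`. -/
theorem floor_equation {a b c : ℕ} (hc : 0 < c) {w x y z x' y' z' : ℝ}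
    (hw : (a + b + c) * w ≤ 1 / 2) (hw0 : 0 < w) (hx : 0 ≤ x) (hy : 0 ≤ y)
    (hxc : InArc 0 w (x / c)) (hyc : InArc 0 w (y / c)) (heq : a * x + b * y = c * z)
    (hx' : x ≤ x') (hy' : y ≤ y') (hz' : z ≤ z')
    (hxx' : x' - x < 1 / 2) (hyy' : y' - y < 1 / 2) (hzz' : z' - z < 1 / 2) :
    a * ⌊x'⌋₊ + b * ⌊y'⌋₊ = c * ⌊z'⌋₊ := by
  have ha0 : (0 : ℝ) ≤ a := a.cast_nonneg
  have hb0 : (0 : ℝ) ≤ b := b.cast_nonneg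
  have hc0 : (0 : ℝ) < c := by exact_mod_cast hc
  have hcw : c * w ≤ 1 / 2 := by nlinarith
  obtain ⟨U, hU, hU1, hU2⟩ := floor_eq_of_inArc hc hx hcw hxc hx' hxx'
  obtain ⟨V, hV, hV1, hV2⟩ := floor_eq_of_inArc hc hy hcw hyc hy' hyy'
  have h1 : a * (c * U) + b * (c * V) ≤ c * z := by
    rw [← heq]
    exact add_le_add (mul_le_mul_of_nonneg_left hU1.le ha0) (mul_le_mul_of_nonneg_left hV1.le hb0)
  have h2 : c * z ≤ a * (c * U + c * w) + b * (c * V + c * w) := by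
    rw [← heq]
    exact add_le_add (mul_le_mul_of_nonneg_left hU2.le ha0) (mul_le_mul_of_nonneg_left hV2.le hb0)
  have h3 : (a * U + b * V : ℝ) ≤ z := le_of_mul_le_mul_left (by linarith) hc0
  have h4 : z ≤ a * U + b * V + (a + b) * w := le_of_mul_le_mul_left (by linarith) hc0
  have h5 : ⌊z'⌋₊ = a * U + b * V := by
    have h6 : (0 : ℝ) ≤ a * U + b * V := by positivity
    rw [Nat.floor_eq_iff (by linarith)]
    push_cast
    have : 0 < c * w := by positivity
    constructor <;> linarith
  rw [hU, hV, h5]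
  ring

/-- Increasing the exponent by less than about `X ^ (-v)` changes powers of numbers up to `X` by less
than `1 / 2`; the factor `X ^ ε / ε` dominates `log X`. -/
theorem rpow_sub_rpow_lt {x X α₀ α v ε δ : ℝ} (hx : 1 ≤ x) (hxX : x ≤ X) (hα₀ : 0 ≤ α₀)
    (hαv : α₀ ≤ v) (hε : 0 < ε) (h1 : α₀ ≤ α) (h2 : α ≤ α₀ + δ)
    (h : 4 * X ^ (v + ε) * δ < ε) : x ^ α - x ^ α₀ < 1 / 2 := by
  have hx0 : 0 < x := by linarith
  have hδ : 0 ≤ δ := by linarith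
  have hlog : 0 ≤ Real.log x := Real.log_nonneg hx
  have hpow : 1 ≤ x ^ α₀ := Real.one_le_rpow hx hα₀
  have hkey : x ^ α₀ * ((α - α₀) * Real.log x) < 1 / 4 := by
    have e1 : Real.log x ≤ x ^ ε / ε := Real.log_le_rpow_div hx0.le hε
    have e2 : x ^ α₀ * x ^ ε ≤ X ^ (v + ε) := by
      rw [← Real.rpow_add hx0]
      exact (Real.rpow_le_rpow_of_exponent_le hx (by linarith)).trans
        (Real.rpow_le_rpow hx0.le hxX (by linarith))
    calc x ^ α₀ * ((α - α₀) * Real.log x) ≤ x ^ α₀ * (δ * (x ^ ε / ε)) := by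
          gcongr; linarith
      _ = x ^ α₀ * x ^ ε * δ / ε := by ring
      _ ≤ X ^ (v + ε) * δ / ε := by gcongr
      _ < 1 / 4 := by rw [div_lt_iff₀ hε]; linarith
  set t := (α - α₀) * Real.log x with ht
  have ht0 : 0 ≤ t := mul_nonneg (by linarith) hlog
  have ht1 : t ≤ 1 / 4 := by nlinarith
  have hexp : Real.exp t - 1 ≤ 2 * t := by
    have := Real.abs_exp_sub_one_le (x := t) (by rw [abs_of_nonneg ht0]; linarith)
    rw [abs_of_nonneg ht0] at this
    exact (le_abs_self _).trans this
  have e3 : x ^ α = x ^ α₀ * Real.exp t := by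
    rw [ht, mul_comm (α - α₀), ← Real.rpow_def_of_pos hx0, ← Real.rpow_add hx0]
    ring_nf
  rw [e3]
  nlinarith

/-! ### The curve of exact solutions -/

/-- The positive number `y` for which `a (1 / p) ^ α + b y ^ α = c`, written through logarithms. This
description applies when `α ≠ 0` and `a (1 / p) ^ α < c`; the definition is used only for `1 ≤ α` and
`2 a < p`, which ensure both. -/
noncomputable def curve (a b c p : ℕ) (α : ℝ) : ℝ :=
  Real.exp (Real.log ((c - a * (p : ℝ) ^ (-α)) / b) / α)

theorem curve_pos (a b c p : ℕ) (α : ℝ) : 0 < curve a b c p α := Real.exp_pos _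

section Curve

variable {a b c p : ℕ} {α : ℝ}

theorem rpow_neg_le_inv (hp : 0 < p) (hα : 1 ≤ α) : (p : ℝ) ^ (-α) ≤ (p : ℝ)⁻¹ := by
  have hp1 : (1 : ℝ) ≤ p := by exact_mod_cast hp
  rw [← Real.rpow_neg_one]
  exact Real.rpow_le_rpow_of_exponent_le hp1 (by linarith)

theorem mul_rpow_neg_le (hc : 0 < c) (hp : 2 * a < p) (hα : 1 ≤ α) :
    a * (p : ℝ) ^ (-α) ≤ c / 2 := by
  have hp0 : (0 : ℝ) < p := by exact_mod_cast (by omega : 0 < p)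
  have hc1 : (1 : ℝ) ≤ c := by exact_mod_cast hc
  have h1 : (2 * a : ℝ) < p := by exact_mod_cast hp
  calc a * (p : ℝ) ^ (-α) ≤ a * (p : ℝ)⁻¹ :=
        mul_le_mul_of_nonneg_left (rpow_neg_le_inv (by omega) hα) a.cast_nonneg
    _ ≤ 1 / 2 := by rw [← div_eq_mul_inv, div_le_iff₀ hp0]; linarith
    _ ≤ c / 2 := by linarith

theorem curve_rpow (hb : 0 < b) (hc : 0 < c) (hp : 2 * a < p) (hα : 1 ≤ α) :
    curve a b c p α ^ α = (c - a * (p : ℝ) ^ (-α)) / b := by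
  have h1 := mul_rpow_neg_le hc hp hα
  have hc0 : (0 : ℝ) < c := by exact_mod_cast hc
  have hb0 : (0 : ℝ) < b := by exact_mod_cast hb
  rw [curve, ← Real.exp_mul, div_mul_cancel₀ _ (by linarith), Real.exp_log]
  exact div_pos (by linarith) hb0

theorem curve_ne_one (ha : 0 < a) (hb : 0 < b) (hc : 0 < c) (hp : 2 * a < p) (hα : 1 ≤ α) :
    curve a b c p α ≠ 1 := by
  intro h
  have h1 := curve_rpow hb hc hp hα
  have hb0 : (0 : ℝ) < b := by exact_mod_cast hb
  have ha0 : (0 : ℝ) < a := by exact_mod_cast ha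
  have hp0 : (0 : ℝ) < p := by exact_mod_cast (by omega : 0 < p)
  have h2 : (0 : ℝ) < a * (p : ℝ) ^ (-α) := mul_pos ha0 (Real.rpow_pos_of_pos hp0 _)
  have h3 := mul_rpow_neg_le one_pos hp hα
  rw [h, Real.one_rpow, eq_div_iff hb0.ne', one_mul] at h1
  -- `c - b` would be an integer strictly between `0` and `1`
  have h4 : (b : ℝ) < c := by linarith
  have h5 : (b : ℝ) + 1 ≤ c := by exact_mod_cast h4
  rw [Nat.cast_one] at h3
  linarith

theorem curve_le (hb : 0 < b) (hc : 0 < c) (hp : 2 * a < p) (hα : 1 ≤ α) :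
    curve a b c p α ≤ c := by
  by_contra! h
  have hc1 : (1 : ℝ) ≤ c := by exact_mod_cast hc
  have hb1 : (1 : ℝ) ≤ b := by exact_mod_cast hb
  have hp0 : (0 : ℝ) < p := by exact_mod_cast (by omega : 0 < p)
  have h1 := Real.rpow_le_rpow_of_exponent_le (hc1.trans h.le) hα
  have h2 : (0 : ℝ) ≤ a * (p : ℝ) ^ (-α) :=
    mul_nonneg a.cast_nonneg (Real.rpow_nonneg hp0.le _)
  rw [Real.rpow_one, curve_rpow hb hc hp hα, le_div_iff₀ (by linarith)] at h1
  nlinarith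

theorem hasStrictDerivAt_curve (hb : 0 < b) (hc : 0 < c) (hp : 2 * a < p) (hα : 1 ≤ α) :
    HasStrictDerivAt (curve a b c p) (curve a b c p α *
      ((α * (a * Real.log p * (p : ℝ) ^ (-α) / (c - a * (p : ℝ) ^ (-α))) -
        Real.log ((c - a * (p : ℝ) ^ (-α)) / b)) / α ^ 2)) α := by
  have hp0 : (0 : ℝ) < p := by exact_mod_cast (by omega : 0 < p)
  have hc0 : (0 : ℝ) < c := by exact_mod_cast hc
  have hb0 : (0 : ℝ) < b := by exact_mod_cast hb
  have h0 := mul_rpow_neg_le hc hp hα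
  have hpos : 0 < (c - a * (p : ℝ) ^ (-α)) / b := div_pos (by linarith) hb0
  have h1 : HasStrictDerivAt (fun x : ℝ => (p : ℝ) ^ (-x))
      ((p : ℝ) ^ (-α) * Real.log p * (-1)) α :=
    (Real.hasStrictDerivAt_const_rpow hp0 (-α)).comp α (hasStrictDerivAt_id α).neg
  have h2 := ((h1.const_mul (a : ℝ)).const_sub (c : ℝ)).div_const (b : ℝ)
  have h3 := ((h2.log hpos.ne').div (hasStrictDerivAt_id α) (by simp; linarith)).exp
  refine h3.congr_deriv ?_
  have : (c : ℝ) - a * (p : ℝ) ^ (-α) ≠ 0 := by linarith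
  simp only [id, curve, Pi.div_apply]
  congr 1
  field_simp

/-- For large `p` the exponent determines the second coordinate in a locally bi-Lipschitz way. If
`b ≥ c`, both `1 / p` and `y` are smaller than `1`, so that both summands of
`a (1 / p) ^ α + b y ^ α` decrease in `α`; if `b < c`, then `y > 1`, and for large `p` the second
summand dominates. -/
theorem eventually_curve_deriv_ne_zero (ha : 0 < a) (hb : 0 < b) (hc : 0 < c) (hα : 1 ≤ α) :
    ∀ᶠ p : ℕ in atTop, ∃ y' : ℝ, y' ≠ 0 ∧ HasStrictDerivAt (curve a b c p) y' α := by
  have hc0 : (0 : ℝ) < c := by exact_mod_cast hc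
  have hb0 : (0 : ℝ) < b := by exact_mod_cast hb
  have ha0 : (0 : ℝ) < a := by exact_mod_cast ha
  suffices h : ∀ᶠ p : ℕ in atTop, α * (a * Real.log p * (p : ℝ) ^ (-α) / (c - a * (p : ℝ) ^ (-α))) -
        Real.log ((c - a * (p : ℝ) ^ (-α)) / b) ≠ 0 by
    filter_upwards [h, eventually_gt_atTop (2 * a)] with p h1 h2
    refine ⟨_, ?_, hasStrictDerivAt_curve hb hc h2 hα⟩
    exact mul_ne_zero (curve_pos _ _ _ _ _).ne' (div_ne_zero h1 (by positivity))
  rcases le_or_gt c b with hcb | hbc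
  · filter_upwards [eventually_gt_atTop (2 * a)] with p hp
    have hp1 : (1 : ℝ) ≤ p := by exact_mod_cast (by omega : 1 ≤ p)
    have h0 := mul_rpow_neg_le hc hp hα
    have hcb' : (c : ℝ) ≤ b := by exact_mod_cast hcb
    have h1 : 0 < a * (p : ℝ) ^ (-α) := mul_pos ha0 (Real.rpow_pos_of_pos (by linarith) _)
    have h2 : Real.log ((c - a * (p : ℝ) ^ (-α)) / b) < 0 :=
      Real.log_neg (div_pos (by linarith) hb0) (by rw [div_lt_one hb0]; linarith)
    have h3 : 0 ≤ α * (a * Real.log p * (p : ℝ) ^ (-α) / (c - a * (p : ℝ) ^ (-α))) := by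
      have := Real.log_nonneg hp1
      have : 0 < c - a * (p : ℝ) ^ (-α) := by linarith
      positivity
    linarith
  · have hlog : 0 < Real.log (c / b) :=
      Real.log_pos (by rw [one_lt_div hb0]; exact_mod_cast hbc)
    have t1 : Tendsto (fun p : ℕ => (p : ℝ) ^ (-α)) atTop (𝓝 0) :=
      (tendsto_rpow_neg_atTop (by linarith)).comp tendsto_natCast_atTop_atTop
    have t2 : Tendsto (fun p : ℕ => Real.log p * (p : ℝ) ^ (-α)) atTop (𝓝 0) := by
      have := ((isLittleO_log_rpow_atTop (show 0 < α by linarith)).tendsto_div_nhds_zero).comp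
        (tendsto_natCast_atTop_atTop (R := ℝ))
      refine this.congr fun p => ?_
      simp [Real.rpow_neg, div_eq_mul_inv]
    have t3 : Tendsto (fun p : ℕ => (c : ℝ) - a * (p : ℝ) ^ (-α)) atTop (𝓝 c) := by
      simpa using (t1.const_mul (a : ℝ)).const_sub (c : ℝ)
    have t4 := ((t2.const_mul (a : ℝ)).div t3 hc0.ne').const_mul α
    have t5 := t4.sub ((t3.div_const (b : ℝ)).log (by positivity))
    simp only [mul_zero, zero_div, zero_sub] at t5
    filter_upwards [t5.eventually_lt_const (neg_lt_zero.2 hlog)] with p hp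
    refine ne_of_lt ?_
    simpa only [Pi.div_apply, mul_assoc] using hp

end Curve

/-! ### Multipliers and the dimension bound -/

theorem inArc_neg {w x : ℝ} (h : InArc (-w) w (-x)) : InArc 0 w x := by
  obtain ⟨z, h1, h2⟩ := h
  refine ⟨-z, ?_, ?_⟩ <;> push_cast <;> linarith

/-- `exists_rpow_inArc` for the arc `(0, w)` and positive coefficients; the sign of the product
`α (α - 1) ⋯ (α - R)` is absorbed by reflecting the arc. -/
theorem exists_rpow_inArc_zero (R : ℕ) {w σ : ℝ} (hw : 0 < w) (hσ : σ = 1 ∨ σ = -1) :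
    ∃ W : ℝ, 0 < W ∧ W ≤ 1 ∧ ∀ (T₁ T₂ α : ℝ) (K : ℕ), 0 ≤ α → α ≤ R + 1 → 0 < K →
      0 < T₁ → 0 < T₂ → 0 < σ * ∏ j ∈ Finset.range (R + 1), (α - j) →
      T₁ * (σ * ∏ j ∈ Finset.range (R + 1), (α - j)) * (K : ℝ) ^ (α - (R + 1)) ≤ W →
      T₂ ≤ W * T₁ →
      1 ≤ W * (T₂ * (σ * ∏ j ∈ Finset.range (R + 1), (α - j)) * (K : ℝ) ^ (α - R)) →
      ∃ k : ℕ, K ≤ k ∧ k ≤ 3 * K ∧ InArc 0 w (T₁ * (k : ℝ) ^ α) ∧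
        InArc 0 w (T₂ * (k : ℝ) ^ α) := by
  obtain ⟨P, hP⟩ : ∃ P : ℝ, ∀ x, InArc P w (σ * x) → InArc 0 w x := by
    rcases hσ with rfl | rfl
    · exact ⟨0, fun x h => by simpa using h⟩
    · exact ⟨-w, fun x h => inArc_neg (by simpa using h)⟩
  obtain ⟨W, hW, hW1, hk⟩ := exists_rpow_inArc R P hw
  refine ⟨W, hW, hW1, fun T₁ T₂ α K hα hαR hK h₁ h₂ hκ ha hb hc => ?_⟩
  set κ := ∏ j ∈ Finset.range (R + 1), (α - j)
  have e : ∀ T, σ * T * κ = T * (σ * κ) := fun T => by ring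
  obtain ⟨k, hk1, hk2, hk3, hk4⟩ := hk (σ * T₁) (σ * T₂) α K hα hαR hK
    (by rw [e]; positivity) (by rw [e]; positivity) (by rwa [e])
    (by rw [e, e, ← mul_assoc W]; exact mul_le_mul_of_nonneg_right hb hκ.le) (by rwa [e])
  rw [mul_assoc] at hk3 hk4
  exact ⟨k, hk1, hk2, hP _ hk3, hP _ hk4⟩

/-- A rational point `(1 / p, m / q)` on the curve with exponent `α₀`, together with a
multiplier `k` for which the numbers `(k q) ^ α₀ / c` and `(k p m) ^ α₀ / c` are slightly larger than
integers, yields a solution for all exponents slightly larger than `α₀`. -/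
theorem Icc_subset_solvableAbove {a b c p q m k N : ℕ} (ha : 0 < a) (hb : 0 < b) (hc : 0 < c)
    (hp : 2 * a < p) {α₀ v ε δ w : ℝ} (hα₀ : 1 ≤ α₀) (hαv : α₀ ≤ v) (hε : 0 < ε)
    (hw : (a + b + c) * w ≤ 1 / 2) (hw0 : 0 < w) (hk : 0 < k) (hNk : N ≤ k) (hq : 0 < q)
    (hm : curve a b c p α₀ * q = m) (hpy : 1 < p * curve a b c p α₀)
    (h₁ : InArc 0 w (((k * q : ℕ) : ℝ) ^ α₀ / c))
    (h₂ : InArc 0 w (((k * (p * m) : ℕ) : ℝ) ^ α₀ / c))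
    (hX : 4 * ((k : ℝ) * (p * q) * c) ^ (v + ε) * δ < ε) :
    Icc α₀ (α₀ + δ) ⊆ solvableAbove a b c N := by
  rintro α ⟨hα, hα'⟩
  have hp0 : 0 < p := by omega
  have hp' : (0 : ℝ) < p := by exact_mod_cast hp0
  have hq' : (0 : ℝ) < q := by exact_mod_cast hq
  have hk' : (0 : ℝ) < k := by exact_mod_cast hk
  have hb' : (0 : ℝ) < b := by exact_mod_cast hb
  have hc1 : (1 : ℝ) ≤ c := by exact_mod_cast hc
  have hp1 : (1 : ℝ) ≤ p := by exact_mod_cast hp0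
  have hy0 := curve_pos a b c p α₀
  have hm0 : 0 < m := by
    have : (0 : ℝ) < m := by rw [← hm]; positivity
    exact_mod_cast this
  have hkq : 0 < k * q := Nat.mul_pos hk hq
  have hkpm : 0 < k * (p * m) := Nat.mul_pos hk (Nat.mul_pos hp0 hm0)
  have hkpq : 0 < k * (p * q) := Nat.mul_pos hk (Nat.mul_pos hp0 hq)
  have hX1 : ((k * q : ℕ) : ℝ) ≤ k * (p * q) * c := by
    push_cast
    have : (k : ℝ) * q ≤ k * (p * q) := by
      have := mul_le_mul_of_nonneg_left hp1 (mul_pos hk' hq').le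
      linarith
    exact this.trans (le_mul_of_one_le_right (by positivity) hc1)
  have hX2 : ((k * (p * m) : ℕ) : ℝ) ≤ k * (p * q) * c := by
    push_cast
    rw [← hm]
    have := mul_le_mul_of_nonneg_left (curve_le hb hc hp hα₀) (show 0 ≤ (k : ℝ) * (p * q) by positivity)
    linarith
  have hX3 : ((k * (p * q) : ℕ) : ℝ) ≤ k * (p * q) * c := by
    push_cast
    exact le_mul_of_one_le_right (by positivity) hc1
  have hincr : ∀ x : ℕ, 0 < x → (x : ℝ) ≤ k * (p * q) * c →
      (x : ℝ) ^ α₀ ≤ (x : ℝ) ^ α ∧ (x : ℝ) ^ α - (x : ℝ) ^ α₀ < 1 / 2 := by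
    intro x hx hxX
    have hx1 : (1 : ℝ) ≤ x := by exact_mod_cast hx
    exact ⟨Real.rpow_le_rpow_of_exponent_le hx1 hα,
      rpow_sub_rpow_lt hx1 hxX (by linarith) hαv hε hα hα' hX⟩
  refine ⟨k * q, k * (p * m), k * (p * q), hkq, hkpm, hkpq, ?_, ?_, ?_, ?_, ?_⟩
  · exact hNk.trans (Nat.le_mul_of_pos_right k (Nat.mul_pos hp0 hq))
  · intro h
    have h3 : (q : ℝ) = p * m := by exact_mod_cast Nat.eq_of_mul_eq_mul_left hk h
    rw [← hm] at h3
    nlinarith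
  · intro h
    have h3 : (q : ℝ) = p * q := by exact_mod_cast Nat.eq_of_mul_eq_mul_left hk h
    have h4 : (1 : ℝ) < p := by
      exact_mod_cast (by omega : 1 < p)
    nlinarith
  · intro h
    have h3 : m = q := Nat.eq_of_mul_eq_mul_left hp0 (Nat.eq_of_mul_eq_mul_left hk h)
    rw [h3] at hm
    exact curve_ne_one ha hb hc hp hα₀ (mul_right_cancel₀ hq'.ne' (by rw [hm, one_mul]))
  · refine floor_equation hc hw hw0 (by positivity) (by positivity) h₁ h₂ ?_
      (hincr _ hkq hX1).1 (hincr _ hkpm hX2).1 (hincr _ hkpq hX3).1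
      (hincr _ hkq hX1).2 (hincr _ hkpm hX2).2 (hincr _ hkpq hX3).2
    push_cast
    rw [← hm, Real.mul_rpow hk'.le hq'.le, Real.mul_rpow hk'.le (by positivity),
      Real.mul_rpow hp'.le (by positivity), Real.mul_rpow hy0.le hq'.le,
      Real.mul_rpow hk'.le (by positivity), Real.mul_rpow hp'.le hq'.le,
      curve_rpow hb hc hp hα₀, Real.rpow_neg hp'.le]
    have := (Real.rpow_pos_of_pos hp' α₀).ne'
    field_simp
    ring

/-- Around every rational point of the curve whose denominator `q = K ^ g` is large there is a
multiplier of size `K` as in `Icc_subset_solvableAbove`. -/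
theorem eventually_Icc_subset_solvableAbove {a b c p g R : ℕ} (ha : 0 < a) (hb : 0 < b) (hc : 0 < c)
    (hp : 2 * a < p) {u₀ v₀ ε ω w W σ κ₀ κ₁ : ℝ} (hu₀ : 1 ≤ u₀)
    (hRu : R < u₀ * (g + 1)) (hRv : v₀ * (g + 1) < R + 1) (hε : 0 < ε)
    (hω : (v₀ + ε) * (g + 1) < ω) (hw : (a + b + c) * w ≤ 1 / 2) (hw0 : 0 < w)
    (hW : 0 < W) (hW1 : W ≤ 1) (hpW : 2 * b < W * (c * p)) (hκ₀ : 0 < κ₀)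
    (hκ : ∀ α ∈ Icc u₀ v₀, κ₀ ≤ σ * ∏ j ∈ Finset.range (R + 1), (α - j) ∧
      σ * ∏ j ∈ Finset.range (R + 1), (α - j) ≤ κ₁)
    (hit : ∀ (T₁ T₂ α : ℝ) (K : ℕ), 0 ≤ α → α ≤ R + 1 → 0 < K →
      0 < T₁ → 0 < T₂ → 0 < σ * ∏ j ∈ Finset.range (R + 1), (α - j) →
      T₁ * (σ * ∏ j ∈ Finset.range (R + 1), (α - j)) * (K : ℝ) ^ (α - (R + 1)) ≤ W →
      T₂ ≤ W * T₁ →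
      1 ≤ W * (T₂ * (σ * ∏ j ∈ Finset.range (R + 1), (α - j)) * (K : ℝ) ^ (α - R)) →
      ∃ k : ℕ, K ≤ k ∧ k ≤ 3 * K ∧ InArc 0 w (T₁ * (k : ℝ) ^ α) ∧
        InArc 0 w (T₂ * (k : ℝ) ^ α)) (N : ℕ) :
    ∀ᶠ K : ℕ in atTop, ∀ α ∈ Icc u₀ v₀, ∀ m : ℕ, curve a b c p α * (K : ℝ) ^ g = m →
      Icc α (α + (K : ℝ) ^ (-ω)) ⊆ solvableAbove a b c N := by
  have hsmall : ∀ x : ℝ, x < 0 → ∀ c η : ℝ, 0 < η → ∀ᶠ K : ℕ in atTop, c * (K : ℝ) ^ x < η :=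
    fun x hx c η hη => (tendsto_natCast_rpow_zero hx c).eventually_lt_const hη
  have hp0 : (0 : ℝ) < p := by exact_mod_cast (by omega : 0 < p)
  have hp1 : (1 : ℝ) ≤ p := by exact_mod_cast (by omega : 1 ≤ p)
  have hb0 : (0 : ℝ) < b := by exact_mod_cast hb
  have ha0 : (0 : ℝ) < a := by exact_mod_cast ha
  have hc0 : (0 : ℝ) < c := by exact_mod_cast hc
  have hg0 : (0 : ℝ) ≤ g := g.cast_nonneg
  filter_upwards [eventually_ge_atTop N, eventually_gt_atTop 0,
    hsmall (v₀ * (g + 1) - (R + 1)) (by linarith) (κ₁ * ((p : ℝ) ^ v₀ / b)) W hW,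
    hsmall (R - u₀ * (g + 1)) (by linarith) (c / (W * κ₀)) 1 one_pos,
    hsmall ((g + 1) * (v₀ + ε) - ω) (by linarith) (4 * (3 * p * c) ^ (v₀ + ε)) ε hε]
    with K hKN hK0 e₁ e₂ e₃ α hα m hm
  obtain ⟨hκα₀, hκα₁⟩ := hκ α hα
  set κ := σ * ∏ j ∈ Finset.range (R + 1), (α - j)
  have hK : (0 : ℝ) < K := by exact_mod_cast hK0
  have hK1 : (1 : ℝ) ≤ K := by exact_mod_cast hK0
  have hα1 : 1 ≤ α := hu₀.trans hα.1
  have hαg : α * (g + 1) ≤ v₀ * (g + 1) := mul_le_mul_of_nonneg_right hα.2 (by linarith)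
  have hαg' : u₀ * (g + 1) ≤ α * (g + 1) := mul_le_mul_of_nonneg_right hα.1 (by linarith)
  have hαR : α ≤ R + 1 := by
    have : α ≤ α * (g + 1) := le_mul_of_one_le_right (by linarith) (by linarith)
    linarith
  have hκ0 : 0 < κ := hκ₀.trans_le hκα₀
  set y := curve a b c p α with hy
  have hy0 : 0 < y := curve_pos a b c p α
  set q : ℕ := K ^ g with hq
  have hqK : ((K : ℝ) ^ g) = (q : ℝ) := by rw [hq]; push_cast; rfl
  have hq0 : 0 < q := pow_pos hK0 g
  have hq' : (0 : ℝ) < q := by exact_mod_cast hq0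
  rw [hqK] at hm
  -- `(p y) ^ α = (c p ^ α - a) / b`
  have hpy : (p * y) ^ α = (c - a * (p : ℝ) ^ (-α)) / b * (p : ℝ) ^ α := by
    rw [Real.mul_rpow hp0.le hy0.le, curve_rpow hb hc hp hα1, mul_comm]
  have hpα : (0 : ℝ) < (p : ℝ) ^ α := Real.rpow_pos_of_pos hp0 _
  have hpα1 : (p : ℝ) ≤ (p : ℝ) ^ α := by
    simpa using Real.rpow_le_rpow_of_exponent_le hp1 hα1
  have hlow : 1 < W * (p * y) ^ α := by
    have h1 := mul_rpow_neg_le hc hp hα1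
    have h2 : (c / 2 : ℝ) / b * p ≤ (p * y) ^ α := by
      have h0 : 0 ≤ (c - a * (p : ℝ) ^ (-α)) / b := div_nonneg (by linarith) hb0.le
      rw [hpy]; gcongr; linarith
    have h3 := mul_le_mul_of_nonneg_left h2 hW.le
    have h4 : W * (c / 2 / b * p) = W * (c * p) / (2 * b) := by field_simp
    have h5 : 1 < W * (c * p) / (2 * b) := by rw [one_lt_div (by positivity)]; exact hpW
    linarith
  have hupp : (p * y) ^ α ≤ c * ((p : ℝ) ^ v₀ / b) := by
    have h1 : (p : ℝ) ^ α ≤ (p : ℝ) ^ v₀ := Real.rpow_le_rpow_of_exponent_le hp1 hα.2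
    have h2 : (0 : ℝ) ≤ a * (p : ℝ) ^ (-α) := mul_nonneg ha0.le (Real.rpow_nonneg hp0.le _)
    calc (p * y) ^ α ≤ c / b * (p : ℝ) ^ v₀ := by
          rw [hpy]; gcongr; linarith
      _ = _ := by ring
  have hpy1 : 1 < p * y := by
    by_contra! h
    have := Real.rpow_le_one (mul_pos hp0 hy0).le h (by linarith : 0 ≤ α)
    nlinarith
  have hqα : (0 : ℝ) < (q : ℝ) ^ α := Real.rpow_pos_of_pos hq' _
  have hqKα : ∀ x : ℝ, (q : ℝ) ^ α * (K : ℝ) ^ (α - x) = (K : ℝ) ^ (α * (g + 1) - x) := by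
    intro x
    rw [← hqK, ← Real.rpow_natCast, ← Real.rpow_mul hK.le, ← Real.rpow_add hK]
    congr 1; ring
  have hpm : ((p * m : ℕ) : ℝ) = p * y * q := by push_cast; rw [← hm]; ring
  have hpmα : ((p * m : ℕ) : ℝ) ^ α = (p * y) ^ α * (q : ℝ) ^ α := by
    rw [hpm, Real.mul_rpow (by positivity) hq'.le]
  have hpyα : 0 < (p * y) ^ α := Real.rpow_pos_of_pos (by positivity) _
  obtain ⟨k, hk1, hk2, hk3, hk4⟩ := hit (((p * m : ℕ) : ℝ) ^ α / c) ((q : ℝ) ^ α / c) α K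
    (by linarith) hαR hK0 (by rw [hpmα]; positivity) (by positivity) hκ0
    (by
      calc ((p * m : ℕ) : ℝ) ^ α / c * κ * (K : ℝ) ^ (α - (R + 1))
          = κ * ((p * y) ^ α / c) * (K : ℝ) ^ (α * (g + 1) - (R + 1)) := by
            rw [hpmα, ← hqKα]; ring
        _ ≤ κ₁ * ((p : ℝ) ^ v₀ / b) * (K : ℝ) ^ (v₀ * (g + 1) - (R + 1)) := by
            have h1 : (p * y) ^ α / c ≤ (p : ℝ) ^ v₀ / b := by
              rw [div_le_iff₀ hc0]; linarith
            have h2 : (K : ℝ) ^ (α * (g + 1) - (R + 1)) ≤ (K : ℝ) ^ (v₀ * (g + 1) - (R + 1)) :=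
              Real.rpow_le_rpow_of_exponent_le hK1 (by linarith)
            have h3 : 0 ≤ κ₁ := hκ0.le.trans hκα₁
            gcongr
        _ ≤ W := e₁.le)
    (by
      rw [hpmα, ← mul_div_assoc, ← mul_assoc]
      gcongr
      exact le_mul_of_one_le_left hqα.le hlow.le)
    (by
      have h1 : W * ((q : ℝ) ^ α / c * κ * (K : ℝ) ^ (α - R)) =
          W * κ / c * (K : ℝ) ^ (α * (g + 1) - R) := by rw [← hqKα]; ring
      have h2 : (K : ℝ) ^ (R - u₀ * (g + 1)) = ((K : ℝ) ^ (u₀ * (g + 1) - R))⁻¹ := by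
        rw [← Real.rpow_neg hK.le]; congr 1; ring
      have h3 : (K : ℝ) ^ (u₀ * (g + 1) - R) ≤ (K : ℝ) ^ (α * (g + 1) - R) :=
        Real.rpow_le_rpow_of_exponent_le hK1 (by linarith)
      have h4 : 0 < (K : ℝ) ^ (u₀ * (g + 1) - R) := Real.rpow_pos_of_pos hK _
      rw [h2, ← div_eq_mul_inv, div_div, div_lt_one (by positivity)] at e₂
      rw [h1, div_mul_eq_mul_div, le_div_iff₀ hc0, one_mul]
      refine e₂.le.trans ?_
      gcongr)
  have hk0 : 0 < k := hK0.trans_le hk1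
  have hk' : (0 : ℝ) < k := by exact_mod_cast hk0
  refine Icc_subset_solvableAbove ha hb hc hp hα1 hα.2 hε hw hw0 hk0 (hKN.trans hk1) hq0 hm hpy1
    ?_ ?_ ?_
  · push_cast
    rw [Real.mul_rpow hk'.le hq'.le, mul_comm, ← div_mul_eq_mul_div]
    exact hk4
  · rw [Nat.cast_mul, Real.mul_rpow hk'.le (Nat.cast_nonneg _), mul_comm, ← div_mul_eq_mul_div]
    exact hk3
  · refine lt_of_le_of_lt ?_ e₃
    have hk3K : (k : ℝ) ≤ 3 * K := by exact_mod_cast hk2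
    have hX : (k : ℝ) * (p * q) * c ≤ 3 * p * c * (K : ℝ) ^ ((g : ℝ) + 1) := by
      rw [Real.rpow_add_one hK.ne', Real.rpow_natCast, hqK]
      have := mul_le_mul_of_nonneg_right hk3K (show 0 ≤ (p : ℝ) * q * c by positivity)
      linarith
    have hv : 0 ≤ v₀ + ε := by linarith [hα.2]
    calc 4 * ((k : ℝ) * (p * q) * c) ^ (v₀ + ε) * (K : ℝ) ^ (-ω)
        ≤ 4 * (3 * p * c * (K : ℝ) ^ ((g : ℝ) + 1)) ^ (v₀ + ε) * (K : ℝ) ^ (-ω) := by gcongr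
      _ = 4 * (3 * p * c) ^ (v₀ + ε) * (K : ℝ) ^ ((g + 1) * (v₀ + ε) - ω) := by
        rw [Real.mul_rpow (by positivity) (by positivity), ← Real.rpow_mul hK.le,
          sub_eq_add_neg, Real.rpow_add hK]
        ring

/-- The set of exponents in `[s, t]` for which the equation is solvable has dimension at least `d` for
every `d < 1 / s`, for all coefficients. -/
theorem ofReal_le_dimH_solvable {a b c : ℕ} (ha : 0 < a) (hb : 0 < b) (hc : 0 < c) {s t d : ℝ}
    (hs : 1 ≤ s) (hst : s < t) (hd : 0 < d) (hds : d * s < 1) :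
    ENNReal.ofReal d ≤
      dimH {α : ℝ | α ∈ Icc s t ∧ IsSolvableIn a b c (piatetskiShapiro α)} := by
  have hd1 : d < 1 := by nlinarith
  -- irrationality keeps `α₁ (g + 1)` and the factors `α₁ - j` away from degenerate values
  obtain ⟨α₁, hirr, hsα, hαt⟩ := exists_irrational_btwn
    (show s < min t (1 / d) from lt_min hst (by rw [lt_div_iff₀ hd]; linarith))
  have hdα : d * α₁ < 1 := by
    have := hαt.trans_le (min_le_right _ _)
    rw [lt_div_iff₀ hd] at this
    linarith
  replace hαt := hαt.trans_le (min_le_left _ _)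
  have hα1 : 1 < α₁ := by linarith
  -- a large `g` makes the multipliers `k ≤ 3 K` negligible compared with the denominators `K ^ g`
  obtain ⟨g, hg⟩ := exists_nat_gt (d * α₁ / (1 - d * α₁))
  rw [div_lt_iff₀ (by linarith)] at hg
  have hg0 : 0 < g := by
    rcases Nat.eq_zero_or_pos g with rfl | h
    · have : 0 < d * α₁ := by positivity
      simp at hg
      linarith
    · exact h
  have hg' : (0 : ℝ) < g := by exact_mod_cast hg0
  obtain ⟨ω, hω1, hω2⟩ := exists_between (show α₁ * (g + 1) < g / d by
    rw [lt_div_iff₀ hd]; linarith)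
  rw [lt_div_iff₀ hd] at hω2
  obtain ⟨ε, hε, hεω⟩ : ∃ ε : ℝ, 0 < ε ∧ (α₁ + ε) * (g + 1) < ω := by
    refine ⟨(ω - α₁ * (g + 1)) / (2 * (g + 1)), div_pos (by linarith) (by positivity), ?_⟩
    have : (α₁ + (ω - α₁ * (g + 1)) / (2 * (g + 1))) * (g + 1) = (α₁ * (g + 1) + ω) / 2 := by
      field_simp; ring
    rw [this]; linarith
  set R : ℕ := ⌊α₁ * (g + 1)⌋₊ with hR
  have hR1 : (R : ℝ) < α₁ * (g + 1) := by
    refine lt_of_le_of_ne (Nat.floor_le (by positivity)) fun h => ?_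
    have := hirr.mul_natCast (Nat.succ_ne_zero g)
    push_cast at this
    exact this.ne_nat R h.symm
  have hR2 : α₁ * (g + 1) < R + 1 := Nat.lt_floor_add_one _
  have hκ1 : ∏ j ∈ Finset.range (R + 1), (α₁ - j) ≠ 0 :=
    Finset.prod_ne_zero_iff.2 fun j _ => sub_ne_zero.2 (hirr.ne_nat j)
  obtain ⟨σ, hσ, hσκ⟩ : ∃ σ : ℝ, (σ = 1 ∨ σ = -1) ∧
      0 < σ * ∏ j ∈ Finset.range (R + 1), (α₁ - j) := by
    rcases lt_or_gt_of_ne hκ1 with h | h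
    · exact ⟨-1, Or.inr rfl, by linarith⟩
    · exact ⟨1, Or.inl rfl, by linarith⟩
  set κ₁ := σ * ∏ j ∈ Finset.range (R + 1), (α₁ - j) with hκ₁
  obtain ⟨w, hw0, hw⟩ : ∃ w : ℝ, 0 < w ∧ (a + b + c) * w ≤ 1 / 2 := by
    have : (0 : ℝ) < a + b + c := by positivity
    exact ⟨1 / (2 * (a + b + c)), by positivity, le_of_eq (by field_simp)⟩
  obtain ⟨W, hW, hW1, hit⟩ := exists_rpow_inArc_zero R hw0 hσ
  obtain ⟨p, hpa, hpW, y', hy', hder⟩ := ((eventually_gt_atTop (2 * a)).and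
    (((tendsto_natCast_atTop_atTop (R := ℝ)).eventually_gt_atTop (2 * b / (W * c))).and
    (eventually_curve_deriv_ne_zero ha hb hc hα1.le))).exists
  have hc0 : (0 : ℝ) < c := by exact_mod_cast hc
  rw [div_lt_iff₀ (by positivity)] at hpW
  have hlip := hder.hasStrictFDerivAt.isLittleO.def (half_pos (abs_pos.2 hy'))
  rw [nhds_prod_eq, eventually_prod_self_iff'] at hlip
  obtain ⟨U, hU, hlip⟩ := hlip
  have hcont : Continuous fun α : ℝ => σ * ∏ j ∈ Finset.range (R + 1), (α - j) := by fun_prop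
  have hnear : ∀ᶠ α in 𝓝 α₁, α ∈ U ∧ s < α ∧ α < t ∧ R < α * (g + 1) ∧ α * (g + 1) < R + 1 ∧
      (α + ε) * (g + 1) < ω ∧ κ₁ / 2 < σ * ∏ j ∈ Finset.range (R + 1), (α - j) ∧
      σ * ∏ j ∈ Finset.range (R + 1), (α - j) < 2 * κ₁ := by
    have hlin : Continuous fun α : ℝ => α * (g + 1) := by fun_prop
    have hlin' : Continuous fun α : ℝ => (α + ε) * (g + 1) := by fun_prop
    exact (eventually_mem_set.2 hU).and ((eventually_gt_nhds hsα).and ((eventually_lt_nhds hαt).and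
      ((hlin.continuousAt.eventually_const_lt hR1).and
      ((hlin.continuousAt.eventually_lt_const hR2).and
      ((hlin'.continuousAt.eventually_lt_const hεω).and
      ((hcont.continuousAt.eventually_const_lt (by linarith)).and
      (hcont.continuousAt.eventually_lt_const (by linarith))))))))
  obtain ⟨r, hr, hball⟩ := Metric.nhds_basis_closedBall.mem_iff.1 hnear
  rw [Real.closedBall_eq_Icc] at hball
  set u₀ := α₁ - r
  set v₀ := α₁ + r
  have huv : u₀ < v₀ := by simp only [u₀, v₀]; linarith
  obtain ⟨-, hsu, -, hRu, -⟩ := hball (left_mem_Icc.2 huv.le)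
  obtain ⟨-, -, hvt, -, hRv, hωv, -⟩ := hball (right_mem_Icc.2 huv.le)
  obtain ⟨θ, hθ, hθy⟩ : ∃ θ : ℝ, (θ = 1 ∨ θ = -1) ∧ θ * y' = |y'| := by
    rcases abs_choice y' with h | h
    · exact ⟨1, Or.inl rfl, by rw [h, one_mul]⟩
    · exact ⟨-1, Or.inr rfl, by rw [h]; ring⟩
  have hθa : |θ| = 1 := by rcases hθ with rfl | rfl <;> simp
  have hy'0 : 0 < |y'| := abs_pos.2 hy'
  have hmain := le_dimH_of_lattice_points (E := solvableAbove a b c) (u₀ := u₀) (v₀ := v₀) (d := d)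
    (ω := ω) (lam := |y'| / 2) (L := 2 * |y'|) (g := g) (Y := fun α => θ * curve a b c p α) huv hd
    hd1 hg0 (by nlinarith) hω2 (by positivity) (by positivity)
    (fun u v hu huv hv => by
      have h1 := hlip v (hball ⟨hu.trans huv, hv⟩).1 u (hball ⟨hu, huv.trans hv⟩).1
      simp only [Real.norm_eq_abs, ContinuousLinearMap.toSpanSingleton_apply, smul_eq_mul] at h1
      rw [abs_of_nonneg (sub_nonneg.2 huv), ← one_mul |_ - _|, ← hθa, ← abs_mul, abs_le] at h1
      have h2 : θ * (curve a b c p v - curve a b c p u - (v - u) * y') =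
          θ * curve a b c p v - θ * curve a b c p u - (v - u) * |y'| := by rw [← hθy]; ring
      rw [h2] at h1
      have h3 : 0 ≤ |y'| * (v - u) := mul_nonneg hy'0.le (by linarith)
      constructor <;> linarith [h1.1, h1.2])
    (fun N => by
      filter_upwards [eventually_Icc_subset_solvableAbove ha hb hc hpa (u₀ := u₀) (v₀ := v₀)
        (by linarith) hRu hRv hε hωv hw hw0 hW hW1 (by linarith) (half_pos hσκ)
        (fun α hα => ⟨(hball hα).2.2.2.2.2.2.1.le, (hball hα).2.2.2.2.2.2.2.le⟩) hit N]
        with K hK α hα z hz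
      obtain ⟨z', hz'⟩ : ∃ z' : ℤ, curve a b c p α * (K : ℝ) ^ g = z' := by
        rcases hθ with rfl | rfl
        · exact ⟨z, by rw [← hz]; ring⟩
        · exact ⟨-z, by push_cast; rw [← hz]; ring⟩
      have hz0 : 0 ≤ z' := by
        have : (0 : ℝ) ≤ z' := by
          rw [← hz']
          exact mul_nonneg (curve_pos _ _ _ _ _).le (by positivity)
        exact_mod_cast this
      lift z' to ℕ using hz0
      exact hK α hα z' (by rw [hz', Int.cast_natCast]))
  refine hmain.trans (dimH_mono fun α hα => ⟨⟨?_, ?_⟩, ?_⟩)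
  · exact hsu.le.trans hα.1.1
  · exact hα.1.2.trans hvt.le
  · exact isSolvableIn_of_mem_iInter (by linarith [hα.1.1]) hα.2

/-- The denominator in `dimBound s` is at most `4`, hence less than `s ^ 2`. -/
theorem dimBound_pos_and_lt {s : ℝ} (hs : 2 < s) : 0 < dimBound s ∧ 2 * dimBound s * s < 1 := by
  have hn : 2 ≤ ⌊s⌋ := Int.le_floor.2 (by exact_mod_cast hs.le)
  have hpow0 : (0 : ℝ) < 2 ^ (1 - ⌊s⌋) := zpow_pos two_pos _
  have hpow : (2 : ℝ) ^ (1 - ⌊s⌋) ≤ 1 := zpow_le_one_of_nonpos₀ (by norm_num) (by omega)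
  have hf0 := Int.fract_nonneg s
  have hf1 := Int.fract_lt_one s
  rw [dimBound]
  set D := (2 + Int.fract s - (2 : ℝ) ^ (1 - ⌊s⌋)) * (2 - Int.fract s) with hD
  have hD0 : 0 < D := mul_pos (by linarith) (by linarith)
  have hD4 : D < s ^ 2 := by
    have : D ≤ 4 := by rw [hD]; nlinarith
    nlinarith
  have hgt : s < s ^ 3 / D := by
    rw [lt_div_iff₀ hD0]
    nlinarith
  have hpos : 0 < s + s ^ 3 / D := by linarith
  refine ⟨inv_pos.2 hpos, ?_⟩
  rw [mul_right_comm, ← div_eq_mul_inv, div_lt_one hpos]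
  linarith

theorem theorem1 (a b c : ℕ) (ha : 0 < a) (hb : 0 < b) (hc : 0 < c)
    (s t : ℝ) (hs : 2 < s) (hst : s < t) :
    0 < dimH {α : ℝ | α ∈ Set.Icc s t ∧ IsSolvableIn a b c (piatetskiShapiro α)} ∧
    ENNReal.ofReal (if a = b ∧ b = c then dimBound s else 2 * dimBound s) ≤
      dimH {α : ℝ | α ∈ Set.Icc s t ∧ IsSolvableIn a b c (piatetskiShapiro α)} := by
  obtain ⟨hpos, hlt⟩ := dimBound_pos_and_lt hs
  have h := ofReal_le_dimH_solvable ha hb hc (by linarith) hst (d := 2 * dimBound s)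
    (by linarith) hlt
  refine ⟨(ENNReal.ofReal_pos.2 (by linarith)).trans_le h,
    (ENNReal.ofReal_le_ofReal ?_).trans h⟩
  split_ifs <;> linarith
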